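/- Let $\Sigma$ be a smooth surface without boundary (Hausdorff, second countable; it may in particular be oriented) and let $\vec\Phi:\Sigma\to\mathbb{R}^m$ be a smooth immersion, i.e. a smooth map with injective differential. In local coordinates let $g_{ij}=\partial_i\vec\Phi\cdot\partial_j\vec\Phi$ be the induced metric, $\nabla$ its covariant derivative (indices are raised with $g$, repeated indices are summed), $\vec h_{ij}=\nabla_i\nabla_j\vec\Phi$ the second fundamental form, $\vec H=\tfrac12 g^{ij}\vec h_{ij}$ the mean curvature vector, $\pi_{\vec n}$ the orthogonal projection of $\mathbb{R}^m$ onto the normal space, and $\Delta_\perp\vec H=\pi_{\vec n}\nabla^j\big(\pi_{\vec n}\nabla_j\vec H\big)$ the Laplacian of the normal bundle. Set $$\vec{\mathcal W}=\Delta_\perp\vec H+(\vec h^i_j\cdot\vec H)\,\vec h^j_i-2|\vec H|^2\vec H,\qquad \vec T^j=\nabla^j\vec H-2\pi_{\vec n}\nabla^j\vec H+|\vec H|^2\nabla^j\vec\Phi .$$ Then the following three conservation laws, corresponding respectively to the invariance of the Willmore energy $\int|\vec H|^2\,d\mathrm{vol}_g$ under translations, rotations and dilations of $\mathbb{R}^m$,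 hold at every point of $\Sigma$: $$\nabla_j\vec T^j=-\vec{\mathcal W},\qquad \nabla_j\big(\vec T^j\wedge\vec\Phi+\vec H\wedge\nabla^j\vec\Phi\big)=-\vec{\mathcal W}\wedge\vec\Phi,\qquad \nabla_j\big(\vec T^j\cdot\vec\Phi\big)=-\vec{\mathcal W}\cdot\vec\Phi .$$ Moreover, $\vec\Phi$ is Willmore if and only if $\nabla_j\vec T^j=\vec 0$ on $\Sigma$. Here $\vec\Phi$ is called Willmore if it is a critical point of the Willmore energy: for every smooth compactly supported $\vec V:\Sigma\to\mathbb{R}^m$, the derivative at $t=0$ of the Willmore energy of $\vec\Phi+t\vec V$ on the support of $\vec V$ exists and is zero. -/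

import Mathlib

open scoped Manifold ContDiff

noncomputable section

namespace Willmore

/-- The ambient Euclidean space `ℝ^m`. -/
abbrev Ambient (m : ℕ) : Type := EuclideanSpace ℝ (Fin m)

/-- The coordinate plane `ℝ²`, in which the charts of a surface take their values. -/
abbrev Plane : Type := EuclideanSpace ℝ (Fin 2)

/-! ### Bivectors of `ℝ^m` -/

/-- The space `Λ²(ℝ^m)` of `2`-vectors. -/
abbrev Bivector (m : ℕ) : Type := ⋀[ℝ]^2 (Ambient m)

/-- The exterior product `v ∧ w` of two vectors. -/
def wedge {m : ℕ} (v w : Ambient m) : Bivector m := exteriorPower.ιMulti ℝ 2 ![v, w]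

/-- Coordinates of a bivector in the basis `eᵢ ∧ eⱼ`, `i < j`. -/
def bivectorCoord (m : ℕ) :
    Bivector m ≃ₗ[ℝ] EuclideanSpace ℝ (Set.powersetCard (Fin m) 2) :=
  ((EuclideanSpace.basisFun (Fin m) ℝ).toBasis.exteriorPower 2).equivFun ≪≫ₗ
    (WithLp.linearEquiv 2 ℝ (Set.powersetCard (Fin m) 2 → ℝ)).symm

/-- The Euclidean norm on `Λ²(ℝ^m)` for which the `eᵢ ∧ eⱼ`, `i < j`, are orthonormal. (It only
serves to differentiate bivector-valued maps.) -/
instance instNormedAddCommGroupBivector (m : ℕ) : NormedAddCommGroup (Bivector m) :=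
  NormedAddCommGroup.induced (Bivector m) (EuclideanSpace ℝ (Set.powersetCard (Fin m) 2))
    (bivectorCoord m) (bivectorCoord m).injective

instance instNormedSpaceBivector (m : ℕ) : NormedSpace ℝ (Bivector m) :=
  NormedSpace.induced ℝ (Bivector m) (EuclideanSpace ℝ (Set.powersetCard (Fin m) 2))
    (bivectorCoord m)

/-! ### Geometry of a parametrized surface `X : ℝ² ⊇ U → ℝ^m` in local coordinates

All derivatives are taken at interior points of the domain `U` on which `X` is a smooth
immersion. Values outside `U` are irrelevant. -/

/-- The coordinate derivative `∂ᵢ f`. -/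
def pd {F : Type*} [NormedAddCommGroup F] [NormedSpace ℝ F] (i : Fin 2) (f : Plane → F)
    (x : Plane) : F :=
  fderiv ℝ f x (EuclideanSpace.single i (1 : ℝ))

section Local

variable {m : ℕ} (X : Plane → Ambient m)

/-- The induced metric `gᵢⱼ = ∂ᵢX · ∂ⱼX`. -/
def metric (x : Plane) : Matrix (Fin 2) (Fin 2) ℝ :=
  Matrix.of fun i j => inner ℝ (pd i X x) (pd j X x)

/-- The inverse metric `gⁱʲ`. -/
def metricInv (x : Plane) : Matrix (Fin 2) (Fin 2) ℝ := (metric X x)⁻¹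

/-- The Christoffel symbols `Γᵏᵢⱼ = ½ gᵏˡ (∂ᵢ gⱼₗ + ∂ⱼ gᵢₗ - ∂ₗ gᵢⱼ)` of the induced metric. -/
def christoffel (k i j : Fin 2) (x : Plane) : ℝ :=
  (1 / 2) * ∑ l, metricInv X x k l *
    (pd i (fun y => metric X y j l) x + pd j (fun y => metric X y i l) x
      - pd l (fun y => metric X y i j) x)

/-- The area density `|g|^{1/2} = √(det g)`. -/
def areaDensity (x : Plane) : ℝ := Real.sqrt (metric X x).det

/-- The tangent plane of the surface, spanned by `∂₁X` and `∂₂X`. -/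
def tangentPlane (x : Plane) : Submodule ℝ (Ambient m) :=
  Submodule.span ℝ (Set.range fun i : Fin 2 => pd i X x)

/-- The orthogonal projection `π_n` of `ℝ^m` onto the normal space of the surface. -/
def normalProj (x : Plane) (v : Ambient m) : Ambient m :=
  (tangentPlane X x)ᗮ.starProjection v

section Covariant

variable {F : Type*} [NormedAddCommGroup F] [NormedSpace ℝ F]

/-- The contravariant derivative `∇ʲf = gʲᵏ ∂ₖf` of a vector-valued function. -/
def gradUp (f : Plane → F) (j : Fin 2) (x : Plane) : F :=
  ∑ k, metricInv X x j k • pd k f x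

/-- The covariant derivative `∇ᵢηⱼ = ∂ᵢηⱼ - Γᵏᵢⱼ ηₖ` of a vector-valued covector field. -/
def covDerivCovector (η : Fin 2 → Plane → F) (i j : Fin 2) (x : Plane) : F :=
  pd i (η j) x - ∑ k, christoffel X k i j x • η k x

/-- The covariant divergence `∇ⱼVʲ = ∂ⱼVʲ + Γʲⱼₖ Vᵏ` of a vector-valued tangent vector field
with components `Vʲ`. -/
def covDiv (V : Fin 2 → Plane → F) (x : Plane) : F :=
  ∑ j, (pd j (V j) x + ∑ k, christoffel X j j k x • V k x)

end Covariant

/-- The second fundamental form `hᵢⱼ = ∇ᵢ∇ⱼX`. -/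
def secondFF (i j : Fin 2) (x : Plane) : Ambient m :=
  covDerivCovector X (fun k => pd k X) i j x

/-- The second fundamental form `hⁱⱼ = gⁱᵏ hₖⱼ` with one index raised. -/
def secondFFMixed (i j : Fin 2) (x : Plane) : Ambient m :=
  ∑ k, metricInv X x i k • secondFF X k j x

/-- The mean curvature vector `H = ½ gⁱʲ hᵢⱼ`. -/
def meanCurvature (x : Plane) : Ambient m :=
  (1 / 2 : ℝ) • ∑ i, ∑ j, metricInv X x i j • secondFF X i j x

/-- The Laplacian `Δ_⊥ N = gⁱʲ π_n ∇ᵢ (π_n ∇ⱼ N)` of the normal bundle, applied to a normal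
field `N`. -/
def normalLaplacian (N : Plane → Ambient m) (x : Plane) : Ambient m :=
  ∑ i, ∑ j, metricInv X x i j •
    normalProj X x (covDerivCovector X (fun k y => normalProj X y (pd k N y)) i j x)

/-- The Willmore operator `𝒲 = Δ_⊥ H + (hⁱⱼ · H) hʲᵢ - 2 |H|² H`. -/
def willmoreOp (x : Plane) : Ambient m :=
  normalLaplacian X (meanCurvature X) x
    + ∑ i, ∑ j, inner ℝ (secondFFMixed X i j x) (meanCurvature X x) • secondFFMixed X j i x
    - (2 * ‖meanCurvature X x‖ ^ 2) • meanCurvature X x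

/-- The components `Tʲ = ∇ʲH - 2 π_n ∇ʲH + |H|² ∇ʲX`. -/
def stress (j : Fin 2) (x : Plane) : Ambient m :=
  gradUp X (meanCurvature X) j x
    - (2 : ℝ) • normalProj X x (gradUp X (meanCurvature X) j x)
    + ‖meanCurvature X x‖ ^ 2 • gradUp X X j x

/-- The Willmore energy density `|H|² |g|^{1/2}` with respect to Lebesgue measure `dx¹dx²`. -/
def energyDensity (x : Plane) : ℝ := ‖meanCurvature X x‖ ^ 2 * areaDensity X x

end Local

/-! ### Immersed surfaces -/

section Global

variable {S : Type*} [TopologicalSpace S] [ChartedSpace Plane S] {m : ℕ}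

/-- A smooth immersion of the surface `S` into `ℝ^m`: a smooth map with injective differential. -/
def IsSmoothImmersion (Φ : S → Ambient m) : Prop :=
  ContMDiff (𝓡 2) 𝓘(ℝ, Ambient m) ∞ Φ ∧
    ∀ p, Function.Injective (mfderiv (𝓡 2) 𝓘(ℝ, Ambient m) Φ p)

/-- The Willmore energy `∫_K |H|² dvol_g` of the piece `K` of the immersed surface `Φ`, computed
by means of a smooth partition of unity `ρ` subordinate to the charts `chartAt p`, as
`∑ₚ ∫ ρₚ |H|² |g|^{1/2} dx¹dx²`, the integral being taken over the part of the coordinate domain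
that corresponds to `K`. For compact `K` only finitely many terms are nonzero. -/
def energyOn (ρ : SmoothPartitionOfUnity S (𝓡 2) S Set.univ) (Φ : S → Ambient m) (K : Set S) :
    ℝ :=
  ∑ᶠ p : S, ∫ x in (chartAt Plane p).target ∩ (chartAt Plane p).symm ⁻¹' K,
    ρ p ((chartAt Plane p).symm x) * energyDensity (Φ ∘ (chartAt Plane p).symm) x

/-- `Φ` is Willmore if it is a critical point of the Willmore energy: the first variation of the
energy of the (compact) support of `V` along `Φ + t V` exists and vanishes, for every smooth
compactly supported `V : S → ℝ^m`. (The surface does not vary outside the support of `V`, and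
the energy does not depend on the partition of unity.) -/
def IsWillmore (Φ : S → Ambient m) : Prop :=
  ∀ ρ : SmoothPartitionOfUnity S (𝓡 2) S Set.univ,
    ρ.IsSubordinate (fun p => (chartAt Plane p).source) →
    ∀ V : S → Ambient m, ContMDiff (𝓡 2) 𝓘(ℝ, Ambient m) ∞ V → HasCompactSupport V →
      HasDerivAt (fun t : ℝ => energyOn ρ (fun p => Φ p + t • V p) (tsupport V)) 0 0

end Global

end Willmore

end

/-! Everything is computed in a coordinate chart, with `X` the immersion read in the chart, and
rests on splitting `T_k` into tangential and normal parts. Put `A_ij = H · h_ij`. Differentiating `H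
· ∂_j X = 0` gives `∂_i H · ∂_j X = -A_ij`, hence `T_k = -π_n ∂_k H - g^{ab} A_kb ∂_a X + |H|² ∂_k
X`.

Translations (`ImmersionOn.covDiv_stress`). The divergence of `T` is tested against tangent and
normal vectors. Against `∂_c X` it gives `-∇^j A_jc + ∂_c |H|² + ∂^j H · h_jc`, which vanishes by
the contracted Codazzi equation. Against a normal vector only derivatives falling on the frame `∂_a
X` add to `-Δ_⊥ H`; they produce `-A^{ja} h_ja + 2 |H|² H`, and the sum is `-𝒲`.

Rotations and dilations (`ImmersionOn.covDiv_wedge`, `ImmersionOn.covDiv_inner`). By the product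
rule it remains to see two algebraic cancellations. `T_k + ∂_k H` is tangential with symmetric
coefficients, so its wedge with `∂^k X` is zero; and `T^j · ∂_j X = -tr A + 2 |H|² = 0`, the 2 being
the dimension of the surface.

Critical points. Since `∂_i (√g ∇^i X) = 2 √g H`, the variation of `|H|² √g` can be found without
varying Christoffel symbols: `ImmersionFamilyOn.fderiv_energyDensity` shows that, for a variation
`V`, it is a coordinate divergence minus `√g ∇_j T^j · V`. The flux vanishes wherever `V` vanishes
locally, so for `V` supported in one chart the first variation of the energy is `-∫ √g ∇_j T^j · V`.
The first variation density is independent of the parametrization and additive in `V`; a partition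
of unity then reduces any compactly supported `V` to this case, and a bump function gives the
converse. -/

namespace Willmore

/-! ### Smooth dependence of the geometry on parameters and coordinates -/

section Families

variable {P F : Type*} [NormedAddCommGroup P] [NormedSpace ℝ P]
  [NormedAddCommGroup F] [NormedSpace ℝ F] {m : ℕ}

/-- A coordinate derivative of a slice is a directional derivative of the joint map. This turns the
exchange of parameter and coordinate derivatives into symmetry of a second derivative. -/
lemma pd_slice_eq_fderiv (i : Fin 2) {f : P × Plane → F} {q : P × Plane}
    (hf : DifferentiableAt ℝ f q) :
    pd i (fun y => f (q.1, y)) q.2 = fderiv ℝ f q (0, EuclideanSpace.single i (1 : ℝ)) := by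
  have h : HasFDerivAt (fun y : Plane => (q.1, y)) (ContinuousLinearMap.inr ℝ P Plane) q.2 :=
    hasFDerivAt_prodMk_right q.1 q.2
  have := HasFDerivAt.comp (g := f) (f := fun y : Plane => (q.1, y)) q.2 hf.hasFDerivAt h
  unfold pd
  erw [this.fderiv]
  simp

lemma contDiffOn_pd_slice {Ω : Set (P × Plane)} (hΩ : IsOpen Ω) {f : P × Plane → F}
    (hf : ContDiffOn ℝ ∞ f Ω) (i : Fin 2) :
    ContDiffOn ℝ ∞ (fun q : P × Plane => pd i (fun y => f (q.1, y)) q.2) Ω := by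
  have h : ContDiffOn ℝ ∞
      (fun q => fderiv ℝ f q ((0 : P), EuclideanSpace.single i (1 : ℝ))) Ω :=
    (hf.fderiv_of_isOpen hΩ le_rfl).clm_apply contDiffOn_const
  refine h.congr fun q hq => pd_slice_eq_fderiv i ?_
  exact (hf.contDiffAt (hΩ.mem_nhds hq)).differentiableAt (by simp)

/-- A smooth family of immersed parametrized surfaces. -/
structure ImmersionFamilyOn (f : P × Plane → Ambient m) (Ω : Set (P × Plane)) : Prop where
  isOpen : IsOpen Ω
  contDiffOn : ContDiffOn ℝ ∞ f Ω
  det_pos : ∀ q ∈ Ω, 0 < (metric (fun y => f (q.1, y)) q.2).det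

lemma metricInv_apply (X : Plane → Ambient m) (x : Plane) (i j : Fin 2) :
    metricInv X x i j = ((metric X x).det)⁻¹ *
      !![metric X x 1 1, -metric X x 0 1; -metric X x 1 0, metric X x 0 0] i j := by
  rw [metricInv, Matrix.inv_def, Matrix.adjugate_fin_two, Ring.inverse_eq_inv']
  rfl

lemma contDiffOn_metric_slice {Ω : Set (P × Plane)} (hΩ : IsOpen Ω) {f : P × Plane → Ambient m}
    (hf : ContDiffOn ℝ ∞ f Ω) (i j : Fin 2) :
    ContDiffOn ℝ ∞ (fun q : P × Plane => metric (fun y => f (q.1, y)) q.2 i j) Ω :=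
  (contDiffOn_pd_slice hΩ hf i).inner ℝ (contDiffOn_pd_slice hΩ hf j)

lemma contDiffOn_det_metric_slice {Ω : Set (P × Plane)} (hΩ : IsOpen Ω)
    {f : P × Plane → Ambient m} (hf : ContDiffOn ℝ ∞ f Ω) :
    ContDiffOn ℝ ∞ (fun q : P × Plane => (metric (fun y => f (q.1, y)) q.2).det) Ω := by
  simp only [Matrix.det_fin_two]
  exact ((contDiffOn_metric_slice hΩ hf 0 0).mul (contDiffOn_metric_slice hΩ hf 1 1)).sub
    ((contDiffOn_metric_slice hΩ hf 0 1).mul (contDiffOn_metric_slice hΩ hf 1 0))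

/-- The immersed slices of a smooth family of maps form an open set. -/
lemma immersionFamilyOn_of_contDiffOn {Ω : Set (P × Plane)} (hΩ : IsOpen Ω)
    {f : P × Plane → Ambient m} (hf : ContDiffOn ℝ ∞ f Ω) :
    ImmersionFamilyOn f (Ω ∩ {q | 0 < (metric (fun y => f (q.1, y)) q.2).det}) where
  isOpen := (contDiffOn_det_metric_slice hΩ hf).continuousOn.isOpen_inter_preimage hΩ isOpen_Ioi
  contDiffOn := hf.mono Set.inter_subset_left
  det_pos _ hq := hq.2

namespace ImmersionFamilyOn

variable {f : P × Plane → Ambient m} {Ω : Set (P × Plane)} (h : ImmersionFamilyOn f Ω)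
include h

lemma contDiffOn_metricInv (i j : Fin 2) :
    ContDiffOn ℝ ∞ (fun q : P × Plane => metricInv (fun y => f (q.1, y)) q.2 i j) Ω := by
  have hd := (contDiffOn_det_metric_slice h.isOpen h.contDiffOn).inv
    fun q hq => (h.det_pos q hq).ne'
  have hm := contDiffOn_metric_slice h.isOpen h.contDiffOn
  simp only [metricInv_apply]
  fin_cases i <;> fin_cases j <;> simp
  · exact hd.mul (hm 1 1)
  · exact (hd.mul (hm 0 1)).neg
  · exact (hd.mul (hm 1 0)).neg
  · exact hd.mul (hm 0 0)

lemma contDiffOn_areaDensity :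
    ContDiffOn ℝ ∞ (fun q : P × Plane => areaDensity (fun y => f (q.1, y)) q.2) Ω :=
  (contDiffOn_det_metric_slice h.isOpen h.contDiffOn).sqrt fun q hq => (h.det_pos q hq).ne'

lemma contDiffOn_christoffel (k i j : Fin 2) :
    ContDiffOn ℝ ∞ (fun q : P × Plane => christoffel (fun y => f (q.1, y)) k i j q.2) Ω := by
  have hm := contDiffOn_metric_slice h.isOpen h.contDiffOn
  refine contDiffOn_const.mul (ContDiffOn.sum fun l _ => (h.contDiffOn_metricInv k l).mul ?_)
  exact ((contDiffOn_pd_slice h.isOpen (hm j l) i).add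
    (contDiffOn_pd_slice h.isOpen (hm i l) j)).sub (contDiffOn_pd_slice h.isOpen (hm i j) l)

lemma contDiffOn_secondFF (i j : Fin 2) :
    ContDiffOn ℝ ∞ (fun q : P × Plane => secondFF (fun y => f (q.1, y)) i j q.2) Ω := by
  have hp := contDiffOn_pd_slice h.isOpen h.contDiffOn
  exact (contDiffOn_pd_slice h.isOpen (hp j) i).sub
    (ContDiffOn.sum fun k _ => (h.contDiffOn_christoffel k i j).smul (hp k))

lemma contDiffOn_meanCurvature :
    ContDiffOn ℝ ∞ (fun q : P × Plane => meanCurvature (fun y => f (q.1, y)) q.2) Ω := by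
  unfold meanCurvature
  exact ContDiffOn.const_smul (1 / 2 : ℝ) (ContDiffOn.sum fun i _ => ContDiffOn.sum fun j _ =>
    (h.contDiffOn_metricInv i j).smul (h.contDiffOn_secondFF i j))

lemma contDiffOn_energyDensity :
    ContDiffOn ℝ ∞ (fun q : P × Plane => energyDensity (fun y => f (q.1, y)) q.2) Ω :=
  (h.contDiffOn_meanCurvature.norm_sq ℝ).mul h.contDiffOn_areaDensity

lemma contDiffOn_gradUp {u : P × Plane → F} (hu : ContDiffOn ℝ ∞ u Ω) (j : Fin 2) :
    ContDiffOn ℝ ∞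
      (fun q : P × Plane => gradUp (fun y => f (q.1, y)) (fun y => u (q.1, y)) j q.2) Ω :=
  ContDiffOn.sum fun k _ => (h.contDiffOn_metricInv j k).smul (contDiffOn_pd_slice h.isOpen hu k)

end ImmersionFamilyOn

end Families

/-! ### Smoothness for one immersion -/

section Single

variable {F : Type*} [NormedAddCommGroup F] [NormedSpace ℝ F] {m : ℕ}

/-- `X` is a smooth immersion of the open set `U` of the plane. -/
structure ImmersionOn (X : Plane → Ambient m) (U : Set Plane) : Prop where
  isOpen : IsOpen U
  contDiffOn : ContDiffOn ℝ ∞ X U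
  det_pos : ∀ x ∈ U, 0 < (metric X x).det

/-- A single map is regarded as a family constant in a real parameter, so that the smoothness
statements for families specialize to it. -/
lemma contDiffOn_of_const_slice {U : Set Plane} {f : Plane → F}
    (hf : ContDiffOn ℝ ∞ (fun q : ℝ × Plane => f q.2) (Set.univ ×ˢ U)) : ContDiffOn ℝ ∞ f U :=
  ContDiffOn.comp (g := fun q : ℝ × Plane => f q.2) (f := fun x : Plane => ((0 : ℝ), x)) hf
    (contDiffOn_const.prodMk contDiffOn_id) fun _ hx => ⟨Set.mem_univ _, hx⟩

lemma contDiffOn_const_slice {U : Set Plane} {f : Plane → F} (hf : ContDiffOn ℝ ∞ f U) :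
    ContDiffOn ℝ ∞ (fun q : ℝ × Plane => f q.2) (Set.univ ×ˢ U) :=
  hf.comp contDiffOn_snd fun _ hq => hq.2

lemma contDiffOn_pd {U : Set Plane} (hU : IsOpen U) {f : Plane → F} (hf : ContDiffOn ℝ ∞ f U)
    (i : Fin 2) : ContDiffOn ℝ ∞ (pd i f) U :=
  contDiffOn_of_const_slice (contDiffOn_pd_slice (isOpen_univ.prod hU) (contDiffOn_const_slice hf) i)

namespace ImmersionOn

variable {X : Plane → Ambient m} {U : Set Plane} (h : ImmersionOn X U)
include h

lemma family : ImmersionFamilyOn (fun q : ℝ × Plane => X q.2) (Set.univ ×ˢ U) where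
  isOpen := isOpen_univ.prod h.isOpen
  contDiffOn := contDiffOn_const_slice h.contDiffOn
  det_pos q hq := h.det_pos q.2 hq.2

lemma contDiffOn_metric (i j : Fin 2) : ContDiffOn ℝ ∞ (fun y => metric X y i j) U :=
  contDiffOn_of_const_slice
    (contDiffOn_metric_slice h.family.isOpen h.family.contDiffOn i j)

lemma contDiffOn_metricInv (i j : Fin 2) : ContDiffOn ℝ ∞ (fun y => metricInv X y i j) U :=
  contDiffOn_of_const_slice (h.family.contDiffOn_metricInv i j)

lemma contDiffOn_areaDensity : ContDiffOn ℝ ∞ (areaDensity X) U :=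
  contDiffOn_of_const_slice h.family.contDiffOn_areaDensity

lemma contDiffOn_christoffel (k i j : Fin 2) : ContDiffOn ℝ ∞ (christoffel X k i j) U :=
  contDiffOn_of_const_slice (h.family.contDiffOn_christoffel k i j)

lemma contDiffOn_meanCurvature : ContDiffOn ℝ ∞ (meanCurvature X) U :=
  contDiffOn_of_const_slice h.family.contDiffOn_meanCurvature

lemma contDiffOn_gradUp {u : Plane → F} (hu : ContDiffOn ℝ ∞ u U) (j : Fin 2) :
    ContDiffOn ℝ ∞ (gradUp X u j) U :=
  contDiffOn_of_const_slice (h.family.contDiffOn_gradUp (contDiffOn_const_slice hu) j)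

end ImmersionOn

end Single

end Willmore

namespace Willmore

/-! ### Derivatives of determinants and inverses of 2 × 2 matrices -/

section MatrixDerivatives

variable {E : Type*} [NormedAddCommGroup E] [NormedSpace ℝ E]
  {g : E → Matrix (Fin 2) (Fin 2) ℝ} {x : E}

lemma fderiv_det_fin_two (hg : ∀ i j, DifferentiableAt ℝ (fun y => g y i j) x) (v : E) :
    fderiv ℝ (fun y => (g y).det) x v =
      fderiv ℝ (fun y => g y 0 0) x v * g x 1 1 + g x 0 0 * fderiv ℝ (fun y => g y 1 1) x v
      - fderiv ℝ (fun y => g y 0 1) x v * g x 1 0 - g x 0 1 * fderiv ℝ (fun y => g y 1 0) x v := by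
  simp only [Matrix.det_fin_two]
  have := ((hg 0 0).hasFDerivAt.mul (hg 1 1).hasFDerivAt).sub
    ((hg 0 1).hasFDerivAt.mul (hg 1 0).hasFDerivAt)
  erw [this.fderiv]
  simp
  ring

lemma differentiableAt_det_fin_two (hg : ∀ i j, DifferentiableAt ℝ (fun y => g y i j) x) :
    DifferentiableAt ℝ (fun y => (g y).det) x := by
  simp only [Matrix.det_fin_two]
  exact ((hg 0 0).mul (hg 1 1)).sub ((hg 0 1).mul (hg 1 0))

lemma inv_fin_two_apply (A : Matrix (Fin 2) (Fin 2) ℝ) (i j : Fin 2) :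
    A⁻¹ i j = A.det⁻¹ * !![A 1 1, -A 0 1; -A 1 0, A 0 0] i j := by
  rw [Matrix.inv_def, Matrix.adjugate_fin_two, Ring.inverse_eq_inv']
  rfl

/-- Jacobi's formula for the square root of a determinant. -/
lemma fderiv_sqrt_det (hg : ∀ i j, DifferentiableAt ℝ (fun y => g y i j) x)
    (hpos : 0 < (g x).det) (v : E) :
    fderiv ℝ (fun y => Real.sqrt (g y).det) x v = Real.sqrt (g x).det / 2 *
      ∑ i, ∑ j, (g x)⁻¹ j i * fderiv ℝ (fun y => g y i j) x v := by
  have h := (differentiableAt_det_fin_two hg).hasFDerivAt.sqrt hpos.ne'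
  rw [h.fderiv]
  have hs : Real.sqrt (g x).det ≠ 0 := (Real.sqrt_pos.2 hpos).ne'
  have h2 : (g x).det = Real.sqrt (g x).det ^ 2 := (Real.sq_sqrt hpos.le).symm
  simp only [smul_apply, smul_eq_mul, fderiv_det_fin_two hg,
    Fin.sum_univ_two, inv_fin_two_apply]
  -- The determinant is expressed through its square root, so that the identity becomes rational in
  -- that root.
  rw [show ((g x).det)⁻¹ = (Real.sqrt (g x).det ^ 2)⁻¹ by rw [← h2]]
  simp
  field_simp
  ring

/-- This is `d(g⁻¹) = -g⁻¹ (dg) g⁻¹`, checked entry by entry from the cofactor formula and the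
quotient rule. -/
lemma fderiv_inv_fin_two (hg : ∀ i j, DifferentiableAt ℝ (fun y => g y i j) x)
    (hpos : (g x).det ≠ 0) (v : E) (i j : Fin 2) :
    fderiv ℝ (fun y => (g y)⁻¹ i j) x v =
      -∑ a, ∑ b, (g x)⁻¹ i a * fderiv ℝ (fun y => g y a b) x v * (g x)⁻¹ b j := by
  have hd := (hasDerivAt_inv hpos).comp_hasFDerivAt x (differentiableAt_det_fin_two hg).hasFDerivAt
  have key : ∀ {f : E → ℝ}, DifferentiableAt ℝ f x →
      fderiv ℝ (fun y => (g y).det⁻¹ * f y) x v =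
        (g x).det⁻¹ * fderiv ℝ f x v
          - fderiv ℝ (fun y => (g y).det) x v * f x / (g x).det ^ 2 := by
    intro f hf
    have := hd.mul hf.hasFDerivAt
    erw [this.fderiv]
    simp
    ring
  have hdet := Matrix.det_fin_two (g x)
  simp only [inv_fin_two_apply, Fin.sum_univ_two]
  fin_cases i <;> fin_cases j <;> simp [-mul_neg]
  · rw [key (hg 1 1), fderiv_det_fin_two hg]
    field_simp
    rw [hdet]; ring
  · rw [key (hg 0 1).fun_neg, fderiv_det_fin_two hg, fderiv_fun_neg]
    simp
    field_simp
    rw [hdet]; ring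
  · rw [key (hg 1 0).fun_neg, fderiv_det_fin_two hg, fderiv_fun_neg]
    simp
    field_simp
    rw [hdet]; ring
  · rw [key (hg 0 0), fderiv_det_fin_two hg]
    field_simp
    rw [hdet]; ring

end MatrixDerivatives

/-! ### Rules for coordinate derivatives -/

section PartialDerivatives

variable {F G W : Type*} [NormedAddCommGroup F] [NormedSpace ℝ F]
  [NormedAddCommGroup G] [NormedSpace ℝ G] [NormedAddCommGroup W] [NormedSpace ℝ W] {x : Plane}

lemma pd_congr {f g : Plane → F} (h : f =ᶠ[nhds x] g) (i : Fin 2) : pd i f x = pd i g x := by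
  rw [pd, pd, h.fderiv_eq]

lemma eventuallyEq_pd {f g : Plane → F} (h : f =ᶠ[nhds x] g) (i : Fin 2) :
    pd i f =ᶠ[nhds x] pd i g :=
  h.eventuallyEq_nhds.mono fun _ hy => pd_congr hy i

lemma pd_add {f g : Plane → F} (hf : DifferentiableAt ℝ f x) (hg : DifferentiableAt ℝ g x)
    (i : Fin 2) : pd i (fun y => f y + g y) x = pd i f x + pd i g x := by
  simp [pd, fderiv_fun_add hf hg]

lemma pd_sub {f g : Plane → F} (hf : DifferentiableAt ℝ f x) (hg : DifferentiableAt ℝ g x)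
    (i : Fin 2) : pd i (fun y => f y - g y) x = pd i f x - pd i g x := by
  simp [pd, fderiv_fun_sub hf hg]

lemma pd_const_smul {f : Plane → F} (hf : DifferentiableAt ℝ f x) (c : ℝ)
    (i : Fin 2) : pd i (fun y => c • f y) x = c • pd i f x := by
  simp [pd, fderiv_fun_const_smul hf]

lemma pd_sum {ι : Type*} {s : Finset ι} {f : ι → Plane → F}
    (hf : ∀ k ∈ s, DifferentiableAt ℝ (f k) x) (i : Fin 2) :
    pd i (fun y => ∑ k ∈ s, f k y) x = ∑ k ∈ s, pd i (f k) x := by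
  simp [pd, fderiv_fun_sum hf]

lemma pd_smul {c : Plane → ℝ} {f : Plane → F} (hc : DifferentiableAt ℝ c x)
    (hf : DifferentiableAt ℝ f x) (i : Fin 2) :
    pd i (fun y => c y • f y) x = pd i c x • f x + c x • pd i f x := by
  simp [pd, fderiv_fun_smul hc hf, add_comm]

lemma pd_mul {c f : Plane → ℝ} (hc : DifferentiableAt ℝ c x)
    (hf : DifferentiableAt ℝ f x) (i : Fin 2) :
    pd i (fun y => c y * f y) x = pd i c x * f x + c x * pd i f x :=
  pd_smul hc hf i

lemma pd_bilin (B : F →L[ℝ] G →L[ℝ] W) {f : Plane → F} {g : Plane → G}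
    (hf : DifferentiableAt ℝ f x) (hg : DifferentiableAt ℝ g x) (i : Fin 2) :
    pd i (fun y => B (f y) (g y)) x = B (pd i f x) (g x) + B (f x) (pd i g x) := by
  have := B.hasFDerivAt_of_bilinear hf.hasFDerivAt hg.hasFDerivAt
  rw [pd, this.fderiv]
  simp [pd, add_comm]

lemma pd_inner {m : ℕ} {f g : Plane → Ambient m} (hf : DifferentiableAt ℝ f x)
    (hg : DifferentiableAt ℝ g x) (i : Fin 2) :
    pd i (fun y => inner ℝ (f y) (g y)) x
      = inner ℝ (pd i f x) (g x) + inner ℝ (f x) (pd i g x) :=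
  pd_bilin (innerSL ℝ) hf hg i

lemma fderiv_fderiv_apply {E : Type*} [NormedAddCommGroup E] [NormedSpace ℝ E] {f : E → F} {z : E}
    (hf : ContDiffAt ℝ ∞ f z) (v w : E) :
    fderiv ℝ (fun y => fderiv ℝ f y v) z w = fderiv ℝ (fderiv ℝ f) z w v := by
  have h : DifferentiableAt ℝ (fderiv ℝ f) z :=
    (hf.fderiv_right (m := ∞) le_rfl).differentiableAt (by simp)
  have := h.hasFDerivAt.clm_apply (hasFDerivAt_const v z)
  rw [this.fderiv]
  simp

lemma fderiv_fderiv_apply_comm {E : Type*} [NormedAddCommGroup E] [NormedSpace ℝ E] {f : E → F}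
    {z : E} (hf : ContDiffAt ℝ ∞ f z) (v w : E) :
    fderiv ℝ (fun y => fderiv ℝ f y v) z w = fderiv ℝ (fun y => fderiv ℝ f y w) z v := by
  rw [fderiv_fderiv_apply hf, fderiv_fderiv_apply hf]
  exact (hf.isSymmSndFDerivAt (by simpa using WithTop.coe_le_coe.2 (le_top : (2 : ℕ∞) ≤ ⊤))) w v

lemma pd_pd_comm {f : Plane → F} (hf : ContDiffAt ℝ ∞ f x) (i j : Fin 2) :
    pd i (pd j f) x = pd j (pd i f) x :=
  fderiv_fderiv_apply_comm hf _ _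

lemma contDiffAt_pd {f : Plane → F} (hf : ContDiffAt ℝ ∞ f x) (i : Fin 2) :
    ContDiffAt ℝ ∞ (pd i f) x :=
  (hf.fderiv_right (m := ∞) le_rfl).clm_apply contDiffAt_const

end PartialDerivatives

end Willmore

/-! ### Metric, Christoffel symbols and covariant divergence -/

namespace Willmore

namespace ImmersionOn

variable {F : Type*} [NormedAddCommGroup F] [NormedSpace ℝ F] {m : ℕ}
  {X : Plane → Ambient m} {U : Set Plane} {x : Plane}

lemma differentiableAt (h : ImmersionOn X U) (hx : x ∈ U) {f : Plane → F}
    (hf : ContDiffOn ℝ ∞ f U) : DifferentiableAt ℝ f x :=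
  (hf.contDiffAt (h.isOpen.mem_nhds hx)).differentiableAt (by simp)

variable (h : ImmersionOn X U) (hx : x ∈ U)
include h hx

lemma contDiffAt : ContDiffAt ℝ ∞ X x := h.contDiffOn.contDiffAt (h.isOpen.mem_nhds hx)

lemma differentiableAt_pd (i : Fin 2) : DifferentiableAt ℝ (pd i X) x :=
  h.differentiableAt hx (contDiffOn_pd h.isOpen h.contDiffOn i)

lemma differentiableAt_metric (i j : Fin 2) : DifferentiableAt ℝ (fun y => metric X y i j) x :=
  h.differentiableAt hx (h.contDiffOn_metric i j)

lemma differentiableAt_metricInv (i j : Fin 2) :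
    DifferentiableAt ℝ (fun y => metricInv X y i j) x :=
  h.differentiableAt hx (h.contDiffOn_metricInv i j)

end ImmersionOn

lemma metric_comm {m : ℕ} (X : Plane → Ambient m) (x : Plane) (i j : Fin 2) :
    metric X x i j = metric X x j i :=
  real_inner_comm (pd j X x) (pd i X x)

lemma metricInv_comm {m : ℕ} (X : Plane → Ambient m) (x : Plane) (i j : Fin 2) :
    metricInv X x i j = metricInv X x j i := by
  have := metric_comm X x 0 1
  fin_cases i <;> fin_cases j <;> simp [metricInv_apply, this]

lemma sum_metricInv_mul_metric {m : ℕ} {X : Plane → Ambient m} {x : Plane}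
    (hd : 0 < (metric X x).det) (i j : Fin 2) :
    ∑ k, metricInv X x i k * metric X x k j = if i = j then 1 else 0 := by
  rw [metricInv, ← Matrix.mul_apply, Matrix.nonsing_inv_mul _ (isUnit_iff_ne_zero.2 hd.ne'),
    Matrix.one_apply]

lemma inner_pd_pd {m : ℕ} (X : Plane → Ambient m) (x : Plane) (i j : Fin 2) :
    inner ℝ (pd i X x) (pd j X x) = metric X x i j := rfl

lemma pd_pd_eq {m : ℕ} (X : Plane → Ambient m) (x : Plane) (i j : Fin 2) :
    pd i (pd j X) x = secondFF X i j x + ∑ k, christoffel X k i j x • pd k X x := by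
  simp [secondFF, covDerivCovector]

/-- The Christoffel terms are linear in the vector field, so they pass through `B` and only the
Leibniz rule for `∂_j` contributes. It is used below for the inner product, the wedge product and
the flipped wedge product. -/
lemma covDiv_bilin {F G W : Type*} [NormedAddCommGroup F] [NormedSpace ℝ F]
    [NormedAddCommGroup G] [NormedSpace ℝ G] [NormedAddCommGroup W] [NormedSpace ℝ W] {m : ℕ}
    {X : Plane → Ambient m} {x : Plane} (B : F →L[ℝ] G →L[ℝ] W) {V : Fin 2 → Plane → F} {f : Plane → G}
    (hV : ∀ j, DifferentiableAt ℝ (V j) x) (hf : DifferentiableAt ℝ f x) :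
    covDiv X (fun j y => B (V j y) (f y)) x =
      B (covDiv X V x) (f x) + ∑ j, B (V j x) (pd j f x) := by
  simp only [covDiv, pd_bilin B (hV _) hf, map_sum, map_add, map_smul,
    FunLike.coe_sum, FunLike.coe_add, FunLike.coe_smul, Finset.sum_apply, Pi.add_apply,
    Pi.smul_apply, Finset.sum_add_distrib]
  abel

lemma areaDensity_pos {m : ℕ} {X : Plane → Ambient m} {x : Plane}
    (hd : 0 < (metric X x).det) : 0 < areaDensity X x := Real.sqrt_pos.2 hd

namespace ImmersionOn

variable {F : Type*} [NormedAddCommGroup F] [NormedSpace ℝ F] {m : ℕ}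
  {X : Plane → Ambient m} {U : Set Plane} {x : Plane} (h : ImmersionOn X U) (hx : x ∈ U)
include h hx

lemma pd_pd_comm (i j : Fin 2) : pd i (pd j X) x = pd j (pd i X) x :=
  Willmore.pd_pd_comm (h.contDiffAt hx) i j

lemma pd_metric (k i j : Fin 2) : pd k (fun y => metric X y i j) x =
    inner ℝ (pd k (pd i X) x) (pd j X x) + inner ℝ (pd i X x) (pd k (pd j X) x) :=
  pd_inner (h.differentiableAt_pd hx i) (h.differentiableAt_pd hx j) k

/-- Expanding the derivatives of `∂_i X · ∂_j X`, the symmetry of second derivatives leaves twice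
one term. The later tensor identities become algebra in the products `∂_i ∂_j X · ∂_l X`. -/
lemma christoffel_eq (k i j : Fin 2) : christoffel X k i j x =
    ∑ l, metricInv X x k l * inner ℝ (pd i (pd j X) x) (pd l X x) := by
  rw [christoffel, Finset.mul_sum]
  refine Finset.sum_congr rfl fun l _ => ?_
  rw [h.pd_metric hx, h.pd_metric hx, h.pd_metric hx, h.pd_pd_comm hx j i, h.pd_pd_comm hx l i,
    h.pd_pd_comm hx l j, real_inner_comm (pd i (pd l X) x)]
  ring

lemma christoffel_comm (k i j : Fin 2) : christoffel X k i j x = christoffel X k j i x := by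
  rw [h.christoffel_eq hx, h.christoffel_eq hx, h.pd_pd_comm hx]

lemma sum_christoffel_mul_metric (i j l : Fin 2) :
    ∑ k, christoffel X k i j x * metric X x k l = inner ℝ (pd i (pd j X) x) (pd l X x) := by
  simp only [h.christoffel_eq hx, Finset.sum_mul]
  rw [Finset.sum_comm]
  calc _ = ∑ a, inner ℝ (pd i (pd j X) x) (pd a X x) *
        ∑ k, metricInv X x a k * metric X x k l := by
        refine Finset.sum_congr rfl fun a _ => ?_
        rw [Finset.mul_sum]
        refine Finset.sum_congr rfl fun k _ => ?_
        rw [metricInv_comm X x a k]; ring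
    _ = _ := by simp [sum_metricInv_mul_metric (h.det_pos x hx)]

lemma secondFF_comm (i j : Fin 2) : secondFF X i j x = secondFF X j i x := by
  simp only [secondFF, covDerivCovector, h.pd_pd_comm hx i j, h.christoffel_comm hx _ i j]

/-- The Christoffel correction is exactly the tangential part of `∂_i ∂_j X`, so `h_ij` is normal.
-/
lemma inner_secondFF_pd (i j l : Fin 2) : inner ℝ (secondFF X i j x) (pd l X x) = 0 := by
  rw [secondFF, covDerivCovector, inner_sub_left, ← h.sum_christoffel_mul_metric hx, sum_inner]
  simp [inner_smul_left, inner_pd_pd]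

lemma inner_meanCurvature_pd (l : Fin 2) : inner ℝ (meanCurvature X x) (pd l X x) = 0 := by
  simp [meanCurvature, inner_smul_left, inner_add_left, h.inner_secondFF_pd hx]

lemma pd_metric_eq (k i j : Fin 2) : pd k (fun y => metric X y i j) x =
    ∑ l, (christoffel X l k i x * metric X x l j + christoffel X l k j x * metric X x l i) := by
  rw [h.pd_metric hx, Finset.sum_add_distrib, h.sum_christoffel_mul_metric hx,
    h.sum_christoffel_mul_metric hx, real_inner_comm (pd i X x)]

/-- The inverse metric is parallel. -/
lemma pd_metricInv (k i j : Fin 2) : pd k (fun y => metricInv X y i j) x =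
    -∑ l, (christoffel X i k l x * metricInv X x l j
      + christoffel X j k l x * metricInv X x l i) := by
  have h1 : pd k (fun y => metricInv X y i j) x = -∑ a, ∑ b,
      metricInv X x i a * pd k (fun y => metric X y a b) x * metricInv X x b j :=
    fderiv_inv_fin_two (h.differentiableAt_metric hx) (h.det_pos x hx).ne' _ i j
  rw [h1]
  simp only [h.pd_metric hx, h.christoffel_eq hx]
  have hc := metricInv_comm X x 0 1
  simp only [Fin.sum_univ_two, real_inner_comm (pd k (pd 0 X) x), real_inner_comm (pd k (pd 1 X) x)]
  fin_cases i <;> fin_cases j <;> simp only [Fin.zero_eta, Fin.mk_one, ← hc] <;> ring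

/-- In Jacobi's formula `½ √g g^{ij} ∂_k g_ij`, the derivative of the metric is a sum of two terms,
each of which contracts to the trace of the Christoffel symbol. -/
lemma pd_areaDensity (k : Fin 2) :
    pd k (areaDensity X) x = areaDensity X x * ∑ j, christoffel X j j k x := by
  have h1 : pd k (areaDensity X) x = areaDensity X x / 2 * ∑ i, ∑ j,
      metricInv X x j i * pd k (fun y => metric X y i j) x :=
    fderiv_sqrt_det (h.differentiableAt_metric hx) (h.det_pos x hx) _
  rw [h1]
  simp only [h.pd_metric hx, h.christoffel_comm hx _ _ k, h.christoffel_eq hx]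
  have hc := metricInv_comm X x 0 1
  simp only [Fin.sum_univ_two, real_inner_comm (pd k (pd 0 X) x), real_inner_comm (pd k (pd 1 X) x),
    ← hc]
  ring

/-- The trace of the Christoffel symbol is the logarithmic derivative of `√g`. In this form the
covariant divergence can be integrated over the coordinate plane. -/
lemma areaDensity_smul_covDiv {V : Fin 2 → Plane → F} (hV : ∀ j, DifferentiableAt ℝ (V j) x) :
    areaDensity X x • covDiv X V x = ∑ j, pd j (fun y => areaDensity X y • V j y) x := by
  have hP := h.differentiableAt hx h.contDiffOn_areaDensity
  simp only [pd_smul hP (hV _), h.pd_areaDensity hx, covDiv, Finset.sum_add_distrib, smul_add]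
  rw [add_comm]
  congr 1
  · rw [Finset.sum_comm, Finset.smul_sum]
    refine Finset.sum_congr rfl fun k _ => ?_
    rw [mul_smul, Finset.sum_smul]
  · rw [Finset.smul_sum]

/-- Since the inverse metric is parallel, raising the index commutes with the covariant derivative.
-/
lemma covDiv_raise {η : Fin 2 → Plane → F} (hη : ∀ j, DifferentiableAt ℝ (η j) x) :
    covDiv X (fun j y => ∑ k, metricInv X y j k • η k y) x =
      ∑ j, ∑ k, metricInv X x j k • covDerivCovector X η j k x := by
  have hg := h.differentiableAt_metricInv hx
  have hp : ∀ j, pd j (fun y => ∑ k, metricInv X y j k • η k y) x =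
      ∑ k, (pd j (fun y => metricInv X y j k) x • η k x + metricInv X x j k • pd j (η k) x) := by
    intro j
    refine (pd_sum (f := fun k y => metricInv X y j k • η k y)
      (fun k _ => (hg j k).smul (hη k)) j).trans ?_
    exact Finset.sum_congr rfl fun k _ => pd_smul (hg j k) (hη k) j
  have hc := metricInv_comm X x 0 1
  have hG := fun k => h.christoffel_comm hx k 0 1
  simp only [covDiv, hp, h.pd_metricInv hx, covDerivCovector]
  simp only [Fin.sum_univ_two, ← hc, ← hG]
  module

end ImmersionOn

end Willmore

/-! ### Normal projection, the lowered stress and the tangential derivative of `H` -/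

namespace Willmore

section Pointwise

variable {m : ℕ} (X : Plane → Ambient m) (x : Plane)

/-- The covector field `T_k = ∂_k H - 2 π_n ∂_k H + |H|² ∂_k X` obtained by lowering the index of
`stress`. -/
noncomputable def stressCovector (k : Fin 2) (x : Plane) : Ambient m :=
  pd k (meanCurvature X) x - (2 : ℝ) • normalProj X x (pd k (meanCurvature X) x)
    + ‖meanCurvature X x‖ ^ 2 • pd k X x

/-- The coefficients `A_ij = H · h_ij` of the second fundamental form in the direction of `H`. -/
noncomputable def meanShape (i j : Fin 2) (x : Plane) : ℝ :=
  inner ℝ (meanCurvature X x) (pd i (pd j X) x)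

lemma stress_eq (j : Fin 2) :
    stress X j x = ∑ k, metricInv X x j k • stressCovector X k x := by
  simp only [stress, gradUp, stressCovector, normalProj, Fin.sum_univ_two, map_add, map_smul]
  module

lemma pd_mem_tangentPlane (i : Fin 2) : pd i X x ∈ tangentPlane X x :=
  Submodule.subset_span ⟨i, rfl⟩

lemma inner_normalProj_pd (v : Ambient m) (i : Fin 2) :
    inner ℝ (normalProj X x v) (pd i X x) = 0 := by
  rw [real_inner_comm]
  exact (tangentPlane X x).mem_orthogonal _ |>.1
    (Submodule.starProjection_apply_mem _ v) _ (pd_mem_tangentPlane X x i)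

lemma mem_orthogonal_tangentPlane {n : Ambient m} (hn : ∀ i, inner ℝ n (pd i X x) = 0) :
    n ∈ (tangentPlane X x)ᗮ := by
  rw [tangentPlane, Submodule.mem_orthogonal]
  intro u hu
  induction hu using Submodule.span_induction with
  | mem u hu => obtain ⟨i, rfl⟩ := hu; rw [real_inner_comm]; exact hn i
  | zero => simp
  | add u v _ _ hu hv => rw [inner_add_left, hu, hv, add_zero]
  | smul a u _ hu => rw [inner_smul_left, hu, mul_zero]

lemma normalProj_of_inner_pd_eq_zero {n : Ambient m} (hn : ∀ i, inner ℝ n (pd i X x) = 0) :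
    normalProj X x n = n :=
  Submodule.starProjection_eq_self_iff.2 (mem_orthogonal_tangentPlane X x hn)

lemma normalProj_pd (i : Fin 2) : normalProj X x (pd i X x) = 0 := by
  rw [normalProj, Submodule.starProjection_apply_eq_zero_iff]
  exact Submodule.le_orthogonal_orthogonal _ (pd_mem_tangentPlane X x i)

lemma inner_normalProj_left {n : Ambient m} (hn : ∀ i, inner ℝ n (pd i X x) = 0) (v : Ambient m) :
    inner ℝ (normalProj X x v) n = inner ℝ v n := by
  rw [normalProj, Submodule.inner_starProjection_left_eq_right]
  exact congrArg _ (normalProj_of_inner_pd_eq_zero X x hn)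

variable {X x}

/-- The difference on the right is orthogonal to the frame because `g⁻¹ g = 1`, and what is
subtracted is tangential. The explicit formula is what makes the projection differentiable in the
base point. -/
lemma normalProj_eq (hd : 0 < (metric X x).det) (v : Ambient m) :
    normalProj X x v =
      v - ∑ a, ∑ b, (metricInv X x a b * inner ℝ v (pd b X x)) • pd a X x := by
  set w : Ambient m := v - ∑ a, ∑ b, (metricInv X x a b * inner ℝ v (pd b X x)) • pd a X x
  have hw : ∀ i, inner ℝ w (pd i X x) = 0 := by
    intro i
    have h0 := sum_metricInv_mul_metric hd 0 i
    have h1 := sum_metricInv_mul_metric hd 1 i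
    have hc := metricInv_comm X x 0 1
    simp only [Fin.sum_univ_two] at h0 h1
    simp only [w, inner_sub_left, Fin.sum_univ_two, inner_add_left, inner_smul_left, inner_pd_pd,
      RCLike.conj_to_real]
    fin_cases i <;> simp at h0 h1 ⊢
    · linear_combination -inner ℝ v (pd 0 X x) * h0 - inner ℝ v (pd 1 X x) * h1 +
        (-inner ℝ v (pd 1 X x) * metric X x 0 0 + inner ℝ v (pd 0 X x) * metric X x 1 0) * hc
    · linear_combination -inner ℝ v (pd 0 X x) * h0 - inner ℝ v (pd 1 X x) * h1 +
        (-inner ℝ v (pd 1 X x) * metric X x 0 1 + inner ℝ v (pd 0 X x) * metric X x 1 1) * hc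
  have hv : v = w + ∑ a, ∑ b, (metricInv X x a b * inner ℝ v (pd b X x)) • pd a X x := by
    simp [w]
  have hz : ∀ i, (tangentPlane X x)ᗮ.starProjection (pd i X x) = 0 := normalProj_pd X x
  have hs : (tangentPlane X x)ᗮ.starProjection w = w := normalProj_of_inner_pd_eq_zero X x hw
  rw [normalProj]
  conv_lhs => rw [hv]
  simp only [map_add, map_sum, map_smul, hs, hz, smul_zero, Finset.sum_const_zero, add_zero]

/-- A vector vanishes if its tangential components and its normal part vanish. -/
lemma eq_zero_of_inner_eq_zero {v : Ambient m} (ht : ∀ i, inner ℝ v (pd i X x) = 0)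
    (hn : ∀ n, (∀ i, inner ℝ n (pd i X x) = 0) → inner ℝ v n = 0) : v = 0 :=
  inner_self_eq_zero.1 (hn v ht)

end Pointwise

namespace ImmersionOn

variable {m : ℕ} {X : Plane → Ambient m} {U : Set Plane} {x : Plane} (h : ImmersionOn X U)
include h

lemma contDiffOn_normalProj {v : Plane → Ambient m} (hv : ContDiffOn ℝ ∞ v U) :
    ContDiffOn ℝ ∞ (fun y => normalProj X y (v y)) U := by
  have hp := contDiffOn_pd h.isOpen h.contDiffOn
  have : ContDiffOn ℝ ∞ (fun y => v y
      - ∑ a, ∑ b, (metricInv X y a b * inner ℝ (v y) (pd b X y)) • pd a X y) U :=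
    hv.sub (ContDiffOn.sum fun a _ => ContDiffOn.sum fun b _ =>
      ((h.contDiffOn_metricInv a b).mul (hv.inner ℝ (hp b))).smul (hp a))
  exact this.congr fun y hy => normalProj_eq (h.det_pos y hy) (v y)

lemma contDiffOn_stressCovector (k : Fin 2) : ContDiffOn ℝ ∞ (stressCovector X k) U := by
  have hH := contDiffOn_pd h.isOpen h.contDiffOn_meanCurvature k
  exact (hH.sub (ContDiffOn.const_smul (2 : ℝ) (h.contDiffOn_normalProj hH))).add
    ((h.contDiffOn_meanCurvature.norm_sq ℝ).smul (contDiffOn_pd h.isOpen h.contDiffOn k))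

lemma contDiffOn_stress (j : Fin 2) : ContDiffOn ℝ ∞ (stress X j) U := by
  have : ContDiffOn ℝ ∞ (fun y => ∑ k, metricInv X y j k • stressCovector X k y) U :=
    ContDiffOn.sum fun k _ => (h.contDiffOn_metricInv j k).smul (h.contDiffOn_stressCovector k)
  exact this.congr fun y _ => stress_eq X y j

lemma contDiffOn_covDiv {F : Type*} [NormedAddCommGroup F] [NormedSpace ℝ F]
    {V : Fin 2 → Plane → F} (hV : ∀ j, ContDiffOn ℝ ∞ (V j) U) :
    ContDiffOn ℝ ∞ (covDiv X V) U :=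
  ContDiffOn.sum fun j _ => (contDiffOn_pd h.isOpen (hV j) j).add
    (ContDiffOn.sum fun k _ => (h.contDiffOn_christoffel j j k).smul (hV k))

variable (hx : x ∈ U)
include hx

/-- Since `H` is normal, the Christoffel part of `∂_i ∂_j X` does not contribute. The form with
plain second derivatives is the one that is convenient to differentiate. -/
lemma meanShape_eq (i j : Fin 2) :
    meanShape X i j x = inner ℝ (meanCurvature X x) (secondFF X i j x) := by
  rw [meanShape, pd_pd_eq]
  simp [inner_add_right, inner_smul_right, h.inner_meanCurvature_pd hx]

/-- Differentiate the orthogonality relation `H · ∂_j X = 0`. -/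
lemma inner_pd_meanCurvature_pd (i j : Fin 2) :
    inner ℝ (pd i (meanCurvature X) x) (pd j X x) = -meanShape X i j x := by
  have h0 : (fun y => inner ℝ (meanCurvature X y) (pd j X y)) =ᶠ[nhds x] fun _ => (0 : ℝ) := by
    filter_upwards [h.isOpen.mem_nhds hx] with y hy using h.inner_meanCurvature_pd hy j
  have h1 := pd_congr h0 i
  rw [pd_inner (h.differentiableAt hx h.contDiffOn_meanCurvature) (h.differentiableAt_pd hx j)] at h1
  have h2 : pd i (fun _ : Plane => (0 : ℝ)) x = 0 := by simp [pd]
  rw [h2] at h1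
  rw [meanShape]
  linarith

/-- The divergence of the gradient is the trace of the Hessian `∇_j ∇_k X = h_jk`. -/
lemma covDiv_gradUp_self : covDiv X (gradUp X X) x = (2 : ℝ) • meanCurvature X x := by
  have := h.covDiv_raise hx (η := fun k => pd k X) (h.differentiableAt_pd hx)
  refine this.trans ?_
  rw [meanCurvature, smul_smul]
  norm_num
  rfl

/-- The trace of `A_ij` is `2 |H|²`. -/
lemma sum_metricInv_mul_meanShape :
    ∑ i, ∑ j, metricInv X x i j * meanShape X i j x = 2 * ‖meanCurvature X x‖ ^ 2 := by
  have h1 : inner ℝ (meanCurvature X x) ((2 : ℝ) • meanCurvature X x)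
      = 2 * ‖meanCurvature X x‖ ^ 2 := by
    rw [inner_smul_right, real_inner_self_eq_norm_sq]
  rw [← h1, meanCurvature, smul_smul]
  norm_num only
  rw [one_smul, ← meanCurvature]
  simp only [inner_sum, inner_smul_right, h.meanShape_eq hx]

end ImmersionOn

end Willmore

/-! ### The conservation law for translations -/

namespace Willmore

namespace ImmersionOn

variable {m : ℕ} {X : Plane → Ambient m} {U : Set Plane} {x : Plane} (h : ImmersionOn X U)
  (hx : x ∈ U)
include h hx

lemma covDiv_stress_eq : covDiv X (stress X) x =
    ∑ j, ∑ k, metricInv X x j k • covDerivCovector X (stressCovector X) j k x := by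
  have hs : stress X = fun j y => ∑ k, metricInv X y j k • stressCovector X k y := by
    funext j y; exact stress_eq X y j
  rw [hs]
  exact h.covDiv_raise hx fun j => h.differentiableAt hx (h.contDiffOn_stressCovector j)

lemma inner_stressCovector_pd (k c : Fin 2) : inner ℝ (stressCovector X k x) (pd c X x) =
    -meanShape X k c x + ‖meanCurvature X x‖ ^ 2 * metric X x k c := by
  simp only [stressCovector, inner_add_left, inner_sub_left, inner_smul_left,
    h.inner_pd_meanCurvature_pd hx, inner_normalProj_pd, inner_pd_pd, RCLike.conj_to_real]
  ring

omit h hx in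
lemma inner_stressCovector_of_normal (k : Fin 2) {n : Ambient m}
    (hn : ∀ i, inner ℝ n (pd i X x) = 0) :
    inner ℝ (stressCovector X k x) n = -inner ℝ (pd k (meanCurvature X) x) n := by
  simp only [stressCovector, inner_add_left, inner_sub_left, inner_smul_left,
    inner_normalProj_left X x hn, (real_inner_comm _ _).trans (hn _), RCLike.conj_to_real]
  ring

lemma differentiableAt_pd_pd (i j : Fin 2) : DifferentiableAt ℝ (pd i (pd j X)) x :=
  h.differentiableAt hx (contDiffOn_pd h.isOpen (contDiffOn_pd h.isOpen h.contDiffOn j) i)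

omit hx in
lemma contDiffOn_meanShape (i j : Fin 2) : ContDiffOn ℝ ∞ (meanShape X i j) U :=
  h.contDiffOn_meanCurvature.inner ℝ
    (contDiffOn_pd h.isOpen (contDiffOn_pd h.isOpen h.contDiffOn j) i)

lemma pd_pd_pd_comm_left (i j k : Fin 2) :
    pd i (pd j (pd k X)) x = pd j (pd i (pd k X)) x :=
  Willmore.pd_pd_comm (contDiffAt_pd (h.contDiffAt hx) k) i j

lemma pd_pd_pd_comm_right (i j k : Fin 2) :
    pd i (pd j (pd k X)) x = pd i (pd k (pd j X)) x := by
  refine pd_congr ?_ i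
  filter_upwards [h.isOpen.mem_nhds hx] with y hy using h.pd_pd_comm hy j k

/-- The tangential part of `∂_i ∂_j X` is evaluated through `∂_k H · ∂_l X = -A_kl`. The third
derivative of `X` is kept as it is: its symmetry in the three indices will play the role of the
Codazzi equation. -/
lemma pd_meanShape (k i j : Fin 2) : pd k (meanShape X i j) x =
    inner ℝ (pd k (meanCurvature X) x) (secondFF X i j x)
      - ∑ l, christoffel X l i j x * meanShape X k l x
      + inner ℝ (meanCurvature X x) (pd k (pd i (pd j X)) x) := by
  have h1 : pd k (meanShape X i j) x =
      inner ℝ (pd k (meanCurvature X) x) (pd i (pd j X) x)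
        + inner ℝ (meanCurvature X x) (pd k (pd i (pd j X)) x) :=
    pd_inner (h.differentiableAt hx h.contDiffOn_meanCurvature) (h.differentiableAt_pd_pd hx i j) k
  rw [h1, pd_pd_eq]
  simp only [inner_add_right, inner_sum, inner_smul_right, h.inner_pd_meanCurvature_pd hx, mul_neg,
    Finset.sum_neg_distrib]
  ring

lemma meanShape_comm (i j : Fin 2) : meanShape X i j x = meanShape X j i x := by
  rw [meanShape, h.pd_pd_comm hx, meanShape]

lemma pd_norm_sq_meanCurvature (k : Fin 2) : pd k (fun y => ‖meanCurvature X y‖ ^ 2) x =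
    2 * inner ℝ (pd k (meanCurvature X) x) (meanCurvature X x) := by
  have hd := h.differentiableAt hx h.contDiffOn_meanCurvature
  have : (fun y => ‖meanCurvature X y‖ ^ 2) =
      fun y => inner ℝ (meanCurvature X y) (meanCurvature X y) := by
    funext y; exact (real_inner_self_eq_norm_sq _).symm
  rw [this, pd_inner hd hd, real_inner_comm (pd k _ x)]
  ring

/-- The contracted Codazzi equation in the direction of `H`: twice the derivative of `|H|²` is the
derivative of the trace of `A`. -/
lemma pd_norm_sq_meanCurvature_eq (c : Fin 2) : 2 * pd c (fun y => ‖meanCurvature X y‖ ^ 2) x =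
    ∑ i, ∑ j, (pd c (fun y => metricInv X y i j) x * meanShape X i j x
      + metricInv X x i j * pd c (meanShape X i j) x) := by
  have hA := fun i j => h.differentiableAt hx (h.contDiffOn_meanShape i j)
  have hg := h.differentiableAt_metricInv hx
  have hN : DifferentiableAt ℝ (fun y => ‖meanCurvature X y‖ ^ 2) x :=
    h.differentiableAt hx (h.contDiffOn_meanCurvature.norm_sq ℝ)
  have h0 : (fun y => ∑ i, ∑ j, metricInv X y i j * meanShape X i j y) =ᶠ[nhds x]
      fun y => (2 : ℝ) • ‖meanCurvature X y‖ ^ 2 := by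
    filter_upwards [h.isOpen.mem_nhds hx] with y hy using h.sum_metricInv_mul_meanShape hy
  have h1 := pd_congr h0 c
  rw [pd_const_smul hN] at h1
  rw [← smul_eq_mul, ← h1]
  refine (pd_sum (f := fun i y => ∑ j, metricInv X y i j * meanShape X i j y)
    (fun i _ => DifferentiableAt.fun_sum fun j _ => (hg i j).mul (hA i j)) c).trans ?_
  refine Finset.sum_congr rfl fun i _ => ?_
  refine (pd_sum (f := fun j y => metricInv X y i j * meanShape X i j y)
    (fun j _ => (hg i j).mul (hA i j)) c).trans ?_
  exact Finset.sum_congr rfl fun j _ => pd_mul (hg i j) (hA i j) c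

/-- Differentiate the known function `T_k · ∂_c X` and subtract `T_k · ∂_j ∂_c X`, the latter split
into its normal part, where `T_k` acts as `-∂_k H`, and its tangential part. -/
lemma inner_pd_stressCovector_pd (j k c : Fin 2) :
    inner ℝ (pd j (stressCovector X k) x) (pd c X x) =
      -pd j (meanShape X k c) x
      + pd j (fun y => ‖meanCurvature X y‖ ^ 2) x * metric X x k c
      + ‖meanCurvature X x‖ ^ 2 * pd j (fun y => metric X y k c) x
      + inner ℝ (pd k (meanCurvature X) x) (secondFF X j c x)
      - ∑ d, christoffel X d j c x *
          (-meanShape X k d x + ‖meanCurvature X x‖ ^ 2 * metric X x k d) := by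
  have hA := h.differentiableAt hx (h.contDiffOn_meanShape k c)
  have hN : DifferentiableAt ℝ (fun y => ‖meanCurvature X y‖ ^ 2) x :=
    h.differentiableAt hx (h.contDiffOn_meanCurvature.norm_sq ℝ)
  have hm := h.differentiableAt_metric hx k c
  have h0 : (fun y => inner ℝ (stressCovector X k y) (pd c X y)) =ᶠ[nhds x] fun y =>
      ‖meanCurvature X y‖ ^ 2 * metric X y k c - meanShape X k c y := by
    filter_upwards [h.isOpen.mem_nhds hx] with y hy
    rw [h.inner_stressCovector_pd hy]; ring
  have h1 := pd_congr h0 j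
  rw [pd_inner (h.differentiableAt hx (h.contDiffOn_stressCovector k))
    (h.differentiableAt_pd hx c)] at h1
  have h2 := pd_sub (hN.mul hm) hA j
  have h3 := pd_mul hN hm j
  have h4 : inner ℝ (stressCovector X k x) (pd j (pd c X) x) =
      -inner ℝ (pd k (meanCurvature X) x) (secondFF X j c x) + ∑ d, christoffel X d j c x *
        (-meanShape X k d x + ‖meanCurvature X x‖ ^ 2 * metric X x k d) := by
    rw [pd_pd_eq, inner_add_right,
      inner_stressCovector_of_normal k (h.inner_secondFF_pd hx j c), inner_sum]
    simp only [inner_smul_right, h.inner_stressCovector_pd hx]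
  rw [h4] at h1
  linear_combination h1 + h2 + h3

/-- Codazzi gives `∇^j A_jc = ∂^j H · h_jc + ∂_c |H|²`, and these terms cancel against those coming
from `|H|² g_jc` and from `-T^j · h_jc`. In coordinates this amounts to `hcod` and `htr`, together
with `g⁻¹ g = 1`. -/
lemma inner_covDiv_stress_pd (c : Fin 2) : inner ℝ (covDiv X (stress X) x) (pd c X x) = 0 := by
  have hcod := h.pd_norm_sq_meanCurvature_eq hx c
  have hN := h.pd_norm_sq_meanCurvature hx c
  have htr : ∑ i, ∑ j, metricInv X x i j * inner ℝ (pd c (meanCurvature X) x) (secondFF X i j x)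
      = pd c (fun y => ‖meanCurvature X y‖ ^ 2) x := by
    rw [hN]
    have : (2 : ℝ) • meanCurvature X x = ∑ i, ∑ j, metricInv X x i j • secondFF X i j x := by
      rw [meanCurvature, smul_smul]; norm_num
    rw [← inner_smul_right (𝕜 := ℝ) (r := (2 : ℝ)), this]
    simp only [inner_sum, inner_smul_right]
  have hg := fun i => sum_metricInv_mul_metric (h.det_pos x hx) i c
  rw [h.covDiv_stress_eq hx]
  simp only [sum_inner, inner_smul_left, covDerivCovector, inner_sub_left,
    h.inner_pd_stressCovector_pd hx, h.inner_stressCovector_pd hx, RCLike.conj_to_real,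
    h.pd_metric_eq hx, h.pd_meanShape hx, h.pd_metricInv hx] at hcod hg ⊢
  have hgc := metricInv_comm X x 0 1
  have hmc := metric_comm X x 0 1
  have hAc := h.meanShape_comm hx 0 1
  have hGc := fun k => h.christoffel_comm hx k 0 1
  have hhc := h.secondFF_comm hx 0 1
  -- Mixed third derivatives are brought to a normal order, so that those from the divergence match
  -- those from the derivative of the trace.
  have h1 : pd 0 (pd 1 (pd 0 X)) x = pd 0 (pd 0 (pd 1 X)) x := h.pd_pd_pd_comm_right hx 0 1 0
  have h2 : pd 1 (pd 0 (pd 0 X)) x = pd 0 (pd 0 (pd 1 X)) x :=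
    (h.pd_pd_pd_comm_left hx 1 0 0).trans h1
  have h3 : pd 1 (pd 0 (pd 1 X)) x = pd 0 (pd 1 (pd 1 X)) x := h.pd_pd_pd_comm_left hx 1 0 1
  have h4 : pd 1 (pd 1 (pd 0 X)) x = pd 0 (pd 1 (pd 1 X)) x :=
    (h.pd_pd_pd_comm_right hx 1 1 0).trans h3
  simp only [Fin.sum_univ_two, ← hgc, ← hmc, ← hAc, ← hGc, ← hhc] at hcod htr hg ⊢
  have hg0 := hg 0
  have hg1 := hg 1
  fin_cases c <;> simp only [Fin.zero_eta, Fin.mk_one, ← hgc, ← hmc, ← hAc, ← hGc, ← hhc,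
    h1, h2, h3, h4, if_true, one_ne_zero, zero_ne_one, if_false] at hcod htr hg0 hg1 ⊢
  · linear_combination hcod + htr + pd 0 (fun y => ‖meanCurvature X y‖ ^ 2) x * hg0
      + pd 1 (fun y => ‖meanCurvature X y‖ ^ 2) x * hg1
  · linear_combination hcod + htr + pd 0 (fun y => ‖meanCurvature X y‖ ^ 2) x * hg0
      + pd 1 (fun y => ‖meanCurvature X y‖ ^ 2) x * hg1

/-- Apart from `-π_n ∂_k H`, the covector `T_k` is a combination of the frame vectors. Derivatives
of its coefficients remain tangential, and `∂_j ∂_a X` has normal part `h_ja`. -/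
lemma inner_covDerivCovector_stressCovector (j k : Fin 2) {n : Ambient m}
    (hn : ∀ i, inner ℝ n (pd i X x) = 0) :
    inner ℝ (covDerivCovector X (stressCovector X) j k x) n =
      -inner ℝ (covDerivCovector X (fun k y => normalProj X y (pd k (meanCurvature X) y)) j k x) n
      - ∑ a, ∑ b, metricInv X x a b * meanShape X k b x * inner ℝ (secondFF X j a x) n
      + ‖meanCurvature X x‖ ^ 2 * inner ℝ (secondFF X j k x) n := by
  have hn' : ∀ i, inner ℝ (pd i X x) n = 0 := fun i => (real_inner_comm _ _).trans (hn i)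
  have hH := contDiffOn_pd h.isOpen h.contDiffOn_meanCurvature
  have hN : DifferentiableAt ℝ (fun y => normalProj X y (pd k (meanCurvature X) y)) x :=
    h.differentiableAt hx (h.contDiffOn_normalProj (hH k))
  have hS : DifferentiableAt ℝ (fun y => ‖meanCurvature X y‖ ^ 2) x :=
    h.differentiableAt hx (h.contDiffOn_meanCurvature.norm_sq ℝ)
  have hp := h.differentiableAt_pd hx
  have hB : ∀ a b, DifferentiableAt ℝ (fun y => metricInv X y a b * meanShape X k b y) x :=
    fun a b => (h.differentiableAt_metricInv hx a b).mul
      (h.differentiableAt hx (h.contDiffOn_meanShape k b))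
  have hsum : ∀ a, DifferentiableAt ℝ
      (fun y => ∑ b, (metricInv X y a b * meanShape X k b y) • pd a X y) x :=
    fun a => DifferentiableAt.fun_sum fun b _ => (hB a b).smul (hp a)
  -- The tangential part of `∂_k H` is `-g^{ab} A_kb ∂_a X`, and its normal part occurs with
  -- coefficient `1 - 2 = -1`.
  have h0 : stressCovector X k =ᶠ[nhds x] fun y =>
      ‖meanCurvature X y‖ ^ 2 • pd k X y - normalProj X y (pd k (meanCurvature X) y)
        - ∑ a, ∑ b, (metricInv X y a b * meanShape X k b y) • pd a X y := by
    filter_upwards [h.isOpen.mem_nhds hx] with y hy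
    have := normalProj_eq (h.det_pos y hy) (pd k (meanCurvature X) y)
    simp only [h.inner_pd_meanCurvature_pd hy, mul_neg, neg_smul, Finset.sum_neg_distrib] at this
    rw [sub_neg_eq_add] at this
    rw [stressCovector, two_smul, this]
    abel
  have h1 : pd j (stressCovector X k) x =
      pd j (fun y => ‖meanCurvature X y‖ ^ 2 • pd k X y) x
        - pd j (fun y => normalProj X y (pd k (meanCurvature X) y)) x
        - ∑ a, ∑ b, pd j (fun y => (metricInv X y a b * meanShape X k b y) • pd a X y) x := by
    have e0 := pd_sub (f := fun y => ‖meanCurvature X y‖ ^ 2 • pd k X y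
        - normalProj X y (pd k (meanCurvature X) y))
      (g := fun y => ∑ a, ∑ b, (metricInv X y a b * meanShape X k b y) • pd a X y)
      ((hS.smul (hp k)).sub hN) (DifferentiableAt.fun_sum fun a _ => hsum a) j
    have e1 := pd_sub (f := fun y => ‖meanCurvature X y‖ ^ 2 • pd k X y)
      (hS.smul (hp k)) hN j
    refine (pd_congr h0 j).trans (e0.trans ?_)
    rw [e1]
    congr 1
    refine (pd_sum (fun a _ => hsum a) j).trans ?_
    exact Finset.sum_congr rfl fun a _ => pd_sum (fun b _ => (hB a b).smul (hp a)) j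
  have h2 := pd_smul hS (hp k) j
  have h3 := fun a b => pd_smul (hB a b) (hp a) j
  simp only [covDerivCovector, h1, h2, h3]
  simp only [inner_sub_left, inner_add_left, sum_inner, inner_smul_left, RCLike.conj_to_real,
    inner_stressCovector_of_normal _ hn, inner_normalProj_left X x hn, pd_pd_eq, hn', mul_zero,
    Finset.sum_const_zero, add_zero, zero_add, Finset.sum_neg_distrib, mul_neg]
  ring

omit h hx in
lemma sum_metricInv_mul_secondFF (n : Ambient m) :
    ∑ i, ∑ j, metricInv X x i j * inner ℝ (secondFF X i j x) n
      = 2 * inner ℝ (meanCurvature X x) n := by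
  have : inner ℝ ((2 : ℝ) • meanCurvature X x) n = 2 * inner ℝ (meanCurvature X x) n := by
    simp [inner_smul_left]
  rw [← this, meanCurvature, smul_smul]
  norm_num only
  simp only [one_smul, sum_inner, inner_smul_left, RCLike.conj_to_real]

lemma willmoreOp_inner_pd (c : Fin 2) : inner ℝ (willmoreOp X x) (pd c X x) = 0 := by
  simp [willmoreOp, normalLaplacian, secondFFMixed, inner_add_left, inner_sub_left,
    inner_smul_left, inner_normalProj_pd, h.inner_secondFF_pd hx, h.inner_meanCurvature_pd hx]

lemma inner_willmoreOp_normal {n : Ambient m} (hn : ∀ i, inner ℝ n (pd i X x) = 0) :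
    inner ℝ (willmoreOp X x) n =
      ∑ i, ∑ j, metricInv X x i j * inner ℝ
        (covDerivCovector X (fun k y => normalProj X y (pd k (meanCurvature X) y)) i j x) n
      + ∑ i, ∑ j, (∑ k, metricInv X x i k * meanShape X k j x) *
          (∑ k, metricInv X x j k * inner ℝ (secondFF X k i x) n)
      - 2 * ‖meanCurvature X x‖ ^ 2 * inner ℝ (meanCurvature X x) n := by
  have hA : ∀ i j, inner ℝ (∑ k, metricInv X x i k • secondFF X k j x) (meanCurvature X x)
      = ∑ k, metricInv X x i k * meanShape X k j x := fun i j => by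
    simp only [sum_inner, inner_smul_left, h.meanShape_eq hx, RCLike.conj_to_real,
      fun k => real_inner_comm (meanCurvature X x) (secondFF X k j x)]
  simp only [willmoreOp, normalLaplacian, secondFFMixed, hA]
  simp only [inner_add_left, inner_sub_left,
    inner_smul_left, sum_inner, inner_normalProj_left X x hn, RCLike.conj_to_real]

/-- The conservation law corresponding to translations. -/
theorem covDiv_stress : covDiv X (stress X) x = -willmoreOp X x := by
  rw [eq_neg_iff_add_eq_zero]
  refine eq_zero_of_inner_eq_zero (X := X) (x := x) (fun c => ?_) fun n hn => ?_
  · rw [inner_add_left, h.inner_covDiv_stress_pd hx, h.willmoreOp_inner_pd hx, add_zero]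
  · have h1 := sum_metricInv_mul_secondFF (X := X) (x := x) n
    rw [inner_add_left, h.inner_willmoreOp_normal hx hn, h.covDiv_stress_eq hx]
    simp only [sum_inner, inner_smul_left, h.inner_covDerivCovector_stressCovector hx _ _ hn,
      RCLike.conj_to_real]
    have hgc := metricInv_comm X x 0 1
    have hAc := h.meanShape_comm hx 0 1
    have hhc := h.secondFF_comm hx 0 1
    simp only [Fin.sum_univ_two, ← hgc, ← hAc, ← hhc] at h1 ⊢
    -- The terms in `Δ_⊥ H` and `A` cancel by the symmetries; the trace `g^{ij} h_ij · n = 2 H · n`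
    -- disposes of the cubic terms.
    linear_combination ‖meanCurvature X x‖ ^ 2 * h1

end ImmersionOn

end Willmore

/-! ### The conservation laws for rotations and dilations -/

namespace Willmore

section Wedge

variable {m : ℕ}

lemma update_cons_zero {α : Type*} (a b c : α) : Function.update ![a, b] 0 c = ![c, b] := by
  ext i
  fin_cases i <;> simp

lemma update_cons_one {α : Type*} (a b c : α) : Function.update ![a, b] 1 c = ![a, c] := by
  ext i
  fin_cases i <;> simp

lemma wedge_add_left (u v w : Ambient m) : wedge (u + v) w = wedge u w + wedge v w := by
  have := (exteriorPower.ιMulti ℝ 2 (M := Ambient m)).map_update_add ![0, w] 0 u v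
  rwa [update_cons_zero, update_cons_zero, update_cons_zero] at this

lemma wedge_smul_left (c : ℝ) (v w : Ambient m) : wedge (c • v) w = c • wedge v w := by
  have := (exteriorPower.ιMulti ℝ 2 (M := Ambient m)).map_update_smul ![0, w] 0 c v
  rwa [update_cons_zero, update_cons_zero] at this

lemma wedge_self (v : Ambient m) : wedge v v = 0 :=
  (exteriorPower.ιMulti ℝ 2 (M := Ambient m)).map_eq_zero_of_eq ![v, v] (i := 0) (j := 1) rfl
    (by decide)

lemma wedge_add_right (u v w : Ambient m) : wedge u (v + w) = wedge u v + wedge u w := by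
  have := (exteriorPower.ιMulti ℝ 2 (M := Ambient m)).map_update_add ![u, 0] 1 v w
  rwa [update_cons_one, update_cons_one, update_cons_one] at this

lemma wedge_smul_right (c : ℝ) (v w : Ambient m) : wedge v (c • w) = c • wedge v w := by
  have := (exteriorPower.ιMulti ℝ 2 (M := Ambient m)).map_update_smul ![v, 0] 1 c w
  rwa [update_cons_one, update_cons_one] at this

lemma wedge_comm (v w : Ambient m) : wedge v w = -wedge w v := by
  have h := wedge_self (v + w)
  rw [wedge_add_left, wedge_add_right, wedge_add_right, wedge_self, wedge_self] at h
  rw [eq_neg_iff_add_eq_zero]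
  simpa using h

/-- The exterior product of two vectors as a continuous bilinear map. -/
noncomputable def wedgeL (m : ℕ) : Ambient m →L[ℝ] Ambient m →L[ℝ] Bivector m :=
  (LinearMap.toContinuousLinearMap (𝕜 := ℝ) (E := Ambient m) (F' := Bivector m)).toLinearMap ∘ₗ
    LinearMap.mk₂ ℝ wedge wedge_add_left wedge_smul_left wedge_add_right wedge_smul_right
    |>.toContinuousLinearMap

lemma wedgeL_apply (v w : Ambient m) : wedgeL m v w = wedge v w := rfl

end Wedge

lemma covDiv_add {F : Type*} [NormedAddCommGroup F] [NormedSpace ℝ F] {m : ℕ}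
    {X : Plane → Ambient m} {x : Plane} {V W : Fin 2 → Plane → F}
    (hV : ∀ j, DifferentiableAt ℝ (V j) x) (hW : ∀ j, DifferentiableAt ℝ (W j) x) :
    covDiv X (fun j y => V j y + W j y) x = covDiv X V x + covDiv X W x := by
  simp only [covDiv, pd_add (hV _) (hW _), smul_add, Finset.sum_add_distrib]
  abel

namespace ImmersionOn

variable {m : ℕ} {X : Plane → Ambient m} {U : Set Plane} {x : Plane} (h : ImmersionOn X U)
  (hx : x ∈ U)
include h hx

/-- The normal part of `∂_k H` has total coefficient `1 - 2 + 1 = 0`, so only twice its tangential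
part survives. -/
lemma stressCovector_add_pd_meanCurvature (k : Fin 2) :
    stressCovector X k x + pd k (meanCurvature X) x = ‖meanCurvature X x‖ ^ 2 • pd k X x
      - (2 : ℝ) • ∑ a, ∑ b, (metricInv X x a b * meanShape X k b x) • pd a X x := by
  have := normalProj_eq (h.det_pos x hx) (pd k (meanCurvature X) x)
  simp only [h.inner_pd_meanCurvature_pd hx, mul_neg, neg_smul, Finset.sum_neg_distrib] at this
  rw [stressCovector, this]
  module

/-- The sum is `g^{jk} (T_k + ∂_k H) ∧ ∂_j X`. The vector in parentheses is tangential, and the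
resulting coefficients of `∂_a X ∧ ∂_j X` are symmetric because `g` and `A` are. -/
lemma sum_wedge_eq_zero : ∑ j, wedge (stress X j x) (pd j X x)
    + ∑ j, wedge (pd j (meanCurvature X) x) (gradUp X X j x) = 0 := by
  have h1 : ∑ j, wedge (stress X j x) (pd j X x)
      + ∑ j, wedge (pd j (meanCurvature X) x) (gradUp X X j x) = ∑ j, ∑ k, metricInv X x j k •
        wedge (stressCovector X k x + pd k (meanCurvature X) x) (pd j X x) := by
    have hgc := metricInv_comm X x 0 1
    simp only [stress_eq, gradUp, Fin.sum_univ_two, wedge_add_left, wedge_add_right,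
      wedge_smul_left, wedge_smul_right, ← hgc]
    module
  have hgc := metricInv_comm X x 0 1
  have hAc := h.meanShape_comm hx 0 1
  have hw := wedge_comm (pd 1 X x) (pd 0 X x)
  rw [h1]
  simp only [h.stressCovector_add_pd_meanCurvature hx, sub_eq_add_neg, ← neg_smul,
    Fin.sum_univ_two, wedge_add_left, wedge_smul_left, wedge_self, hw, ← hgc, ← hAc]
  module

/-- The conservation law corresponding to rotations. -/
theorem covDiv_wedge : covDiv X (fun j y => wedge (stress X j y) (X y)
      + wedge (meanCurvature X y) (gradUp X X j y)) x = -wedge (willmoreOp X x) (X x) := by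
  have hT : ∀ j, DifferentiableAt ℝ (stress X j) x :=
    fun j => h.differentiableAt hx (h.contDiffOn_stress j)
  have hG : ∀ j, DifferentiableAt ℝ (gradUp X X j) x :=
    fun j => h.differentiableAt hx (h.contDiffOn_gradUp h.contDiffOn j)
  have hX := h.differentiableAt hx h.contDiffOn
  have hH := h.differentiableAt hx h.contDiffOn_meanCurvature
  have h1 := covDiv_bilin (X := X) (wedgeL m) hT hX
  -- The product rule expects the vector field in the first slot, whereas `∇^j X` is the second
  -- factor of `H ∧ ∇^j X`.
  have h2 := covDiv_bilin (X := X) (wedgeL m).flip hG hH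
  have h3 := covDiv_add (X := X) (x := x) (V := fun j y => wedgeL m (stress X j y) (X y))
    (W := fun j y => (wedgeL m).flip (gradUp X X j y) (meanCurvature X y))
    (fun j => ((wedgeL m).hasFDerivAt_of_bilinear (hT j).hasFDerivAt
      hX.hasFDerivAt).differentiableAt)
    (fun j => ((wedgeL m).flip.hasFDerivAt_of_bilinear (hG j).hasFDerivAt
      hH.hasFDerivAt).differentiableAt)
  rw [h1, h2, h.covDiv_stress hx, h.covDiv_gradUp_self hx] at h3
  refine h3.trans ?_
  simp only [ContinuousLinearMap.flip_apply, wedgeL_apply, wedge_smul_right, wedge_self, smul_zero,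
    zero_add]
  rw [add_assoc, h.sum_wedge_eq_zero hx, add_zero, ← neg_one_smul ℝ, wedge_smul_left, neg_one_smul]

/-- The conservation law corresponding to dilations. -/
theorem covDiv_inner : covDiv X (fun j y => inner ℝ (stress X j y) (X y)) x
    = -inner ℝ (willmoreOp X x) (X x) := by
  have h1 := covDiv_bilin (X := X) (innerSL ℝ)
    (fun j => h.differentiableAt hx (h.contDiffOn_stress j)) (h.differentiableAt hx h.contDiffOn)
  -- Dimension two enters here: the trace of `A` is `2 |H|²`, and the trace of `|H|² g` is also `2
  -- |H|²`.
  have h2 : ∑ j, inner ℝ (stress X j x) (pd j X x) = 0 := by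
    have ht := h.sum_metricInv_mul_meanShape hx
    have hg0 := sum_metricInv_mul_metric (h.det_pos x hx) 0 0
    have hg1 := sum_metricInv_mul_metric (h.det_pos x hx) 1 1
    have hgc := metricInv_comm X x 0 1
    have hAc := h.meanShape_comm hx 0 1
    simp only [stress_eq, sum_inner, inner_smul_left, h.inner_stressCovector_pd hx,
      RCLike.conj_to_real]
    simp only [Fin.sum_univ_two, if_true] at ht hg0 hg1 ⊢
    linear_combination -ht + ‖meanCurvature X x‖ ^ 2 * (hg0 + hg1) +
      (meanShape X 0 1 x - meanShape X 1 0 x) * hgc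
  refine h1.trans ?_
  change inner ℝ (covDiv X (stress X) x) (X x) + ∑ j, inner ℝ (stress X j x) (pd j X x) = _
  simp only [h2, add_zero, h.covDiv_stress hx, inner_neg_left]

end ImmersionOn

end Willmore

/-! ### The first variation of the energy density -/

namespace Willmore

lemma fderiv_smul_apply {E F : Type*} [NormedAddCommGroup E] [NormedSpace ℝ E]
    [NormedAddCommGroup F] [NormedSpace ℝ F] {c : E → ℝ} {u : E → F} {x : E}
    (hc : DifferentiableAt ℝ c x) (hu : DifferentiableAt ℝ u x) (v : E) :
    fderiv ℝ (fun y => c y • u y) x v = fderiv ℝ c x v • u x + c x • fderiv ℝ u x v := by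
  rw [fderiv_fun_smul hc hu]
  simp [add_comm]

lemma fderiv_sum_smul_apply {ι E F : Type*} [NormedAddCommGroup E] [NormedSpace ℝ E]
    [NormedAddCommGroup F] [NormedSpace ℝ F] {s : Finset ι} {c : ι → E → ℝ} {u : ι → E → F} {x : E}
    (hc : ∀ k, DifferentiableAt ℝ (c k) x) (hu : ∀ k, DifferentiableAt ℝ (u k) x) (v : E) :
    fderiv ℝ (fun y => ∑ k ∈ s, c k y • u k y) x v =
      ∑ k ∈ s, (fderiv ℝ (c k) x v • u k x + c k x • fderiv ℝ (u k) x v) := by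
  rw [fderiv_fun_sum fun k _ => (hc k).fun_smul (hu k)]
  simp [fderiv_smul_apply (hc _) (hu _)]

/-- The vector density `√g ∇ⁱ X`, whose coordinate divergence is `2 √g H`. -/
noncomputable def areaGrad {m : ℕ} (X : Plane → Ambient m) (i : Fin 2) (y : Plane) : Ambient m :=
  areaDensity X y • gradUp X X i y

namespace ImmersionOn

variable {m : ℕ} {X : Plane → Ambient m} {U : Set Plane} {x : Plane} (h : ImmersionOn X U)
include h

/-- This is `∇_j ∇^j X = 2 H` multiplied by `√g`. It expresses `√g H` as a coordinate divergence of
quantities involving only first derivatives of `X`. -/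
lemma sum_pd_areaGrad (hx : x ∈ U) :
    ∑ i, pd i (areaGrad X i) x = (2 * areaDensity X x) • meanCurvature X x := by
  have := h.areaDensity_smul_covDiv hx (V := gradUp X X)
    fun j => h.differentiableAt hx (h.contDiffOn_gradUp h.contDiffOn j)
  rw [h.covDiv_gradUp_self hx, smul_smul, mul_comm] at this
  exact this.symm

end ImmersionOn

namespace ImmersionFamilyOn

variable {P : Type*} [NormedAddCommGroup P] [NormedSpace ℝ P] {F : Type*} [NormedAddCommGroup F]
  [NormedSpace ℝ F] {m : ℕ} {f : P × Plane → Ambient m} {Ω : Set (P × Plane)}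
  (h : ImmersionFamilyOn f Ω) {q : P × Plane}
include h

lemma immersionOn_slice (t : P) : ImmersionOn (fun y => f (t, y)) {y | (t, y) ∈ Ω} where
  isOpen := h.isOpen.preimage (by fun_prop)
  contDiffOn := h.contDiffOn.comp (contDiffOn_const.prodMk contDiffOn_id) fun _ hy => hy
  det_pos y hy := h.det_pos (t, y) hy

lemma contDiffOn_areaGrad (i : Fin 2) :
    ContDiffOn ℝ ∞ (fun q : P × Plane => areaGrad (fun y => f (q.1, y)) i q.2) Ω :=
  h.contDiffOn_areaDensity.smul (h.contDiffOn_gradUp h.contDiffOn i)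

/-- Differentiation with respect to parameters preserves smoothness. -/
lemma contDiffOn_fderiv_param {u : P × Plane → F} (hu : ContDiffOn ℝ ∞ u Ω) (v : P × Plane) :
    ContDiffOn ℝ ∞ (fun q => fderiv ℝ u q v) Ω :=
  (hu.fderiv_of_isOpen h.isOpen le_rfl).clm_apply contDiffOn_const

omit h in
lemma contDiffOn_slice {u : P × Plane → F} (hu : ContDiffOn ℝ ∞ u Ω) (t : P) :
    ContDiffOn ℝ ∞ (fun y => u (t, y)) {y | (t, y) ∈ Ω} :=
  hu.comp (contDiffOn_const.prodMk contDiffOn_id) fun _ hy => hy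

variable (hq : q ∈ Ω)
include hq

lemma differentiableAt {u : P × Plane → F} (hu : ContDiffOn ℝ ∞ u Ω) : DifferentiableAt ℝ u q :=
  (hu.contDiffAt (h.isOpen.mem_nhds hq)).differentiableAt (by simp)

/-- Parameter derivatives commute with coordinate derivatives. -/
lemma fderiv_pd_slice {u : P × Plane → F} (hu : ContDiffOn ℝ ∞ u Ω) (v : P) (i : Fin 2) :
    fderiv ℝ (fun q : P × Plane => pd i (fun y => u (q.1, y)) q.2) q (v, 0) =
      pd i (fun y => fderiv ℝ u (q.1, y) (v, 0)) q.2 := by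
  have h1 : (fun q : P × Plane => pd i (fun y => u (q.1, y)) q.2) =ᶠ[nhds q]
      fun q => fderiv ℝ u q (0, EuclideanSpace.single i (1 : ℝ)) := by
    filter_upwards [h.isOpen.mem_nhds hq] with q' hq'
    exact pd_slice_eq_fderiv i (h.differentiableAt hq' hu)
  rw [h1.fderiv_eq, fderiv_fderiv_apply_comm (hu.contDiffAt (h.isOpen.mem_nhds hq))]
  exact (pd_slice_eq_fderiv i (h.differentiableAt hq (h.contDiffOn_fderiv_param hu (v, 0)))).symm

lemma fderiv_metric (v : P) (i j : Fin 2) :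
    fderiv ℝ (fun q : P × Plane => metric (fun y => f (q.1, y)) q.2 i j) q (v, 0) =
      inner ℝ (pd i (fun y => fderiv ℝ f (q.1, y) (v, 0)) q.2) (pd j (fun y => f (q.1, y)) q.2)
      + inner ℝ (pd i (fun y => f (q.1, y)) q.2)
          (pd j (fun y => fderiv ℝ f (q.1, y) (v, 0)) q.2) := by
  have hp := fun i => h.differentiableAt hq (contDiffOn_pd_slice h.isOpen h.contDiffOn i)
  have := fderiv_inner_apply ℝ (hp i) (hp j) (v, 0)
  refine this.trans ?_
  rw [h.fderiv_pd_slice hq h.contDiffOn, h.fderiv_pd_slice hq h.contDiffOn, add_comm]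

lemma fderiv_areaDensity (v : P) :
    fderiv ℝ (fun q : P × Plane => areaDensity (fun y => f (q.1, y)) q.2) q (v, 0) =
      areaDensity (fun y => f (q.1, y)) q.2 / 2 * ∑ i, ∑ j,
        metricInv (fun y => f (q.1, y)) q.2 j i *
          fderiv ℝ (fun q : P × Plane => metric (fun y => f (q.1, y)) q.2 i j) q (v, 0) :=
  fderiv_sqrt_det (g := fun q : P × Plane => metric (fun y => f (q.1, y)) q.2)
    (fun i j => h.differentiableAt hq (contDiffOn_metric_slice h.isOpen h.contDiffOn i j))
    (h.det_pos q hq) (v, 0)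

lemma fderiv_metricInv (v : P) (i j : Fin 2) :
    fderiv ℝ (fun q : P × Plane => metricInv (fun y => f (q.1, y)) q.2 i j) q (v, 0) =
      -∑ a, ∑ b, metricInv (fun y => f (q.1, y)) q.2 i a *
          fderiv ℝ (fun q : P × Plane => metric (fun y => f (q.1, y)) q.2 a b) q (v, 0) *
        metricInv (fun y => f (q.1, y)) q.2 b j :=
  fderiv_inv_fin_two (g := fun q : P × Plane => metric (fun y => f (q.1, y)) q.2)
    (fun i j => h.differentiableAt hq (contDiffOn_metric_slice h.isOpen h.contDiffOn i j))
    (h.det_pos q hq).ne' (v, 0) i j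

lemma fderiv_areaGrad (v : P) (i : Fin 2) :
    fderiv ℝ (fun q : P × Plane => areaGrad (fun y => f (q.1, y)) i q.2) q (v, 0) =
      fderiv ℝ (fun q : P × Plane => areaDensity (fun y => f (q.1, y)) q.2) q (v, 0) •
        gradUp (fun y => f (q.1, y)) (fun y => f (q.1, y)) i q.2
      + areaDensity (fun y => f (q.1, y)) q.2 • ∑ k,
        (fderiv ℝ (fun q : P × Plane => metricInv (fun y => f (q.1, y)) q.2 i k) q (v, 0) •
            pd k (fun y => f (q.1, y)) q.2
          + metricInv (fun y => f (q.1, y)) q.2 i k •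
            pd k (fun y => fderiv ℝ f (q.1, y) (v, 0)) q.2) := by
  have hp := fun k => h.differentiableAt hq (contDiffOn_pd_slice h.isOpen h.contDiffOn k)
  have hg := fun i k => h.differentiableAt hq (h.contDiffOn_metricInv i k)
  have h2 := fderiv_sum_smul_apply (s := Finset.univ) (hg i) hp (v, 0)
  simp only [h.fderiv_pd_slice hq h.contDiffOn] at h2
  rw [← h2]
  exact fderiv_smul_apply (h.differentiableAt hq h.contDiffOn_areaDensity)
    (h.differentiableAt hq (h.contDiffOn_gradUp h.contDiffOn i)) (v, 0)

end ImmersionFamilyOn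

end Willmore

namespace Willmore

namespace ImmersionFamilyOn

variable {P : Type*} [NormedAddCommGroup P] [NormedSpace ℝ P] {m : ℕ}
  {f : P × Plane → Ambient m} {Ω : Set (P × Plane)} (h : ImmersionFamilyOn f Ω) {q : P × Plane}
include h

/-- Pairing `δ(2 √g H)` with `H` gives `2 |H|² δ√g + 2 √g H · δH`, which exceeds `δ(|H|² √g)` by
exactly `|H|² δ√g`. -/
lemma fderiv_energyDensity_aux (hq : q ∈ Ω) (w : P × Plane) :
    fderiv ℝ (fun q : P × Plane => energyDensity (fun y => f (q.1, y)) q.2) q w =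
      inner ℝ (meanCurvature (fun y => f (q.1, y)) q.2)
        (fderiv ℝ (fun q : P × Plane =>
          ∑ i, pd i (areaGrad (fun y => f (q.1, y)) i) q.2) q w)
      - ‖meanCurvature (fun y => f (q.1, y)) q.2‖ ^ 2 *
        fderiv ℝ (fun q : P × Plane => areaDensity (fun y => f (q.1, y)) q.2) q w := by
  have hH := h.differentiableAt hq h.contDiffOn_meanCurvature
  have hA := h.differentiableAt hq h.contDiffOn_areaDensity
  have h1 : (fun q : P × Plane => ∑ i, pd i (areaGrad (fun y => f (q.1, y)) i) q.2) =ᶠ[nhds q]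
      fun q => (2 * areaDensity (fun y => f (q.1, y)) q.2) •
        meanCurvature (fun y => f (q.1, y)) q.2 := by
    filter_upwards [h.isOpen.mem_nhds hq] with q' hq'
    exact (h.immersionOn_slice q'.1).sum_pd_areaGrad hq'
  have h2 : (fun q : P × Plane => energyDensity (fun y => f (q.1, y)) q.2) = fun q =>
      inner ℝ (meanCurvature (fun y => f (q.1, y)) q.2) (meanCurvature (fun y => f (q.1, y)) q.2) •
        areaDensity (fun y => f (q.1, y)) q.2 := by
    funext q
    rw [energyDensity, real_inner_self_eq_norm_sq, smul_eq_mul]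
  rw [h1.fderiv_eq, fderiv_smul_apply (hA.const_mul 2) hH, fderiv_const_mul hA, h2,
    fderiv_smul_apply (hH.inner ℝ hH) hA, fderiv_inner_apply ℝ hH hH,
    inner_add_right, inner_smul_right, inner_smul_right, real_inner_self_eq_norm_sq,
    real_inner_comm (meanCurvature _ _)]
  simp
  ring

/-- The part of the first variation that does not contain second derivatives of the variation. -/
lemma sum_inner_pd_meanCurvature_fderiv_areaGrad (hq : q ∈ Ω) (v : P) :
    -∑ i, inner ℝ (pd i (meanCurvature (fun y => f (q.1, y))) q.2)
        (fderiv ℝ (fun q : P × Plane => areaGrad (fun y => f (q.1, y)) i q.2) q (v, 0))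
      - ‖meanCurvature (fun y => f (q.1, y)) q.2‖ ^ 2 *
        fderiv ℝ (fun q : P × Plane => areaDensity (fun y => f (q.1, y)) q.2) q (v, 0) =
    areaDensity (fun y => f (q.1, y)) q.2 * ∑ i, inner ℝ (stress (fun y => f (q.1, y)) i q.2)
      (pd i (fun y => fderiv ℝ f (q.1, y) (v, 0)) q.2) := by
  have hX := h.immersionOn_slice q.1
  have hx : q.2 ∈ {y | (q.1, y) ∈ Ω} := hq
  have hτ : ∀ k, stressCovector (fun y => f (q.1, y)) k q.2 = _ :=
    fun k => eq_sub_of_add_eq (hX.stressCovector_add_pd_meanCurvature hx k)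
  have ht := hX.sum_metricInv_mul_meanShape hx
  have hgc := metricInv_comm (fun y => f (q.1, y)) q.2 0 1
  have hAc := hX.meanShape_comm hx 0 1
  simp only [h.fderiv_areaGrad hq, h.fderiv_areaDensity hq, h.fderiv_metricInv hq,
    h.fderiv_metric hq, stress_eq, hτ, gradUp]
  simp only [Fin.sum_univ_two, inner_add_left, inner_sub_left, inner_add_right, inner_smul_left,
    inner_smul_right, RCLike.conj_to_real, hX.inner_pd_meanCurvature_pd hx] at ht ⊢
  -- With all derivatives expanded, the identity is purely algebraic in the metric, the frame, `A`,
  -- and the derivatives of `H` and of the variation.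
  generalize meanCurvature (fun y => f (q.1, y)) = H at *
  generalize meanShape (fun y => f (q.1, y)) = A at *
  generalize metricInv (fun y => f (q.1, y)) q.2 = g at *
  generalize areaDensity (fun y => f (q.1, y)) q.2 = a at *
  generalize pd 0 (fun y => f (q.1, y)) q.2 = X0 at *
  generalize pd 1 (fun y => f (q.1, y)) q.2 = X1 at *
  generalize pd 0 (fun y => fderiv ℝ f (q.1, y) (v, 0)) q.2 = V0 at *
  generalize pd 1 (fun y => fderiv ℝ f (q.1, y) (v, 0)) q.2 = V1 at *
  simp only [real_inner_comm X0, real_inner_comm X1, ← hgc, ← hAc] at ht ⊢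
  -- The coefficient is `δ√g = √g g^{ij} ∂_i X · ∂_j V`. It multiplies the trace of `A` that arises
  -- from `-∂_i H · ∇^i X`.
  linear_combination (a * (g 0 0 * inner ℝ X0 V0 + g 0 1 * inner ℝ X1 V0 + g 0 1 * inner ℝ X0 V1
    + g 1 1 * inner ℝ X1 V1)) * ht

/-- The first variation formula for the Willmore energy density: up to a divergence, it is the
pairing of the variation with the divergence of the stress. -/
theorem fderiv_energyDensity (hq : q ∈ Ω) (v : P) :
    fderiv ℝ (fun q : P × Plane => energyDensity (fun y => f (q.1, y)) q.2) q (v, 0) =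
      ∑ i, pd i (fun y =>
        inner ℝ (meanCurvature (fun z => f (q.1, z)) y) (fderiv ℝ (fun r : P × Plane =>
          areaGrad (fun z => f (r.1, z)) i r.2) (q.1, y) (v, 0))
        + inner ℝ (areaDensity (fun z => f (q.1, z)) y • stress (fun z => f (q.1, z)) i y)
          (fderiv ℝ f (q.1, y) (v, 0))) q.2
      - areaDensity (fun z => f (q.1, z)) q.2 *
        inner ℝ (covDiv (fun z => f (q.1, z)) (stress (fun z => f (q.1, z))) q.2)
          (fderiv ℝ f q (v, 0)) := by
  have hX := h.immersionOn_slice q.1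
  have hx : q.2 ∈ {y | (q.1, y) ∈ Ω} := hq
  have hG := fun i => h.contDiffOn_areaGrad i
  have hH := hX.differentiableAt hx hX.contDiffOn_meanCurvature
  have hD := fun i => hX.differentiableAt hx
    (contDiffOn_slice (h.contDiffOn_fderiv_param (hG i) (v, 0)) q.1)
  have hT : ∀ i, DifferentiableAt ℝ (fun y => areaDensity (fun z => f (q.1, z)) y •
      stress (fun z => f (q.1, z)) i y) q.2 := fun i => hX.differentiableAt hx
    (hX.contDiffOn_areaDensity.smul (hX.contDiffOn_stress i))
  have hV := hX.differentiableAt hx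
    (contDiffOn_slice (h.contDiffOn_fderiv_param h.contDiffOn (v, 0)) q.1)
  have h1 : fderiv ℝ (fun q : P × Plane => ∑ i, pd i (areaGrad (fun y => f (q.1, y)) i) q.2) q
      (v, 0) = ∑ i, pd i (fun y => fderiv ℝ (fun r : P × Plane =>
          areaGrad (fun z => f (r.1, z)) i r.2) (q.1, y) (v, 0)) q.2 := by
    rw [fderiv_fun_sum fun i _ => h.differentiableAt hq (contDiffOn_pd_slice h.isOpen (hG i) i)]
    rw [FunLike.coe_sum, Finset.sum_apply]
    exact Finset.sum_congr rfl fun i _ => h.fderiv_pd_slice hq (hG i) v i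
  have h2 := fun i => pd_inner hH (hD i) i
  have h3 := fun i => pd_inner (hT i) hV i
  have h4 := fun i => pd_add (hH.inner ℝ (hD i)) ((hT i).inner ℝ hV) i
  have h5 := hX.areaDensity_smul_covDiv hx (V := stress (fun z => f (q.1, z)))
    fun j => hX.differentiableAt hx (hX.contDiffOn_stress j)
  have h6 := congrArg (fun w => inner ℝ w (fderiv ℝ f q (v, 0))) h5
  simp only [sum_inner, inner_smul_left, RCLike.conj_to_real] at h6
  have h7 := h.sum_inner_pd_meanCurvature_fderiv_areaGrad hq v
  rw [h.fderiv_energyDensity_aux hq, h1, Finset.sum_congr rfl fun i _ => h4 i,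
    Finset.sum_add_distrib, Finset.sum_congr rfl fun i _ => h2 i,
    Finset.sum_congr rfl fun i _ => h3 i, h6, inner_sum]
  simp only [Finset.sum_add_distrib, inner_smul_left, RCLike.conj_to_real, ← Finset.mul_sum,
    Prod.mk.eta] at h7 ⊢
  linear_combination h7

end ImmersionFamilyOn

end Willmore

/-! ### Locality and change of coordinates -/

namespace Willmore

section Locality

variable {m : ℕ} {X Y : Plane → Ambient m} {x : Plane}

lemma metric_congr (h : X =ᶠ[nhds x] Y) : metric X x = metric Y x := by
  ext i j
  rw [← inner_pd_pd, ← inner_pd_pd, pd_congr h, pd_congr h]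

lemma metricInv_congr (h : X =ᶠ[nhds x] Y) : metricInv X x = metricInv Y x := by
  rw [metricInv, metricInv, metric_congr h]

lemma areaDensity_congr (h : X =ᶠ[nhds x] Y) : areaDensity X x = areaDensity Y x := by
  rw [areaDensity, areaDensity, metric_congr h]

lemma christoffel_congr (h : X =ᶠ[nhds x] Y) (k i j : Fin 2) :
    christoffel X k i j x = christoffel Y k i j x := by
  have hm : ∀ i j, (fun y => metric X y i j) =ᶠ[nhds x] fun y => metric Y y i j := fun i j =>
    h.eventuallyEq_nhds.mono fun y hy => congrFun (congrFun (metric_congr hy) i) j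
  simp only [christoffel, metricInv_congr h, pd_congr (hm _ _)]

lemma secondFF_congr (h : X =ᶠ[nhds x] Y) (i j : Fin 2) : secondFF X i j x = secondFF Y i j x := by
  simp only [secondFF, covDerivCovector, christoffel_congr h, pd_congr h,
    pd_congr (eventuallyEq_pd h j)]

lemma meanCurvature_congr (h : X =ᶠ[nhds x] Y) : meanCurvature X x = meanCurvature Y x := by
  simp only [meanCurvature, secondFF_congr h, metricInv_congr h]

lemma energyDensity_congr (h : X =ᶠ[nhds x] Y) : energyDensity X x = energyDensity Y x := by
  rw [energyDensity, energyDensity, meanCurvature_congr h, areaDensity_congr h]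

lemma areaGrad_congr (h : X =ᶠ[nhds x] Y) (i : Fin 2) : areaGrad X i x = areaGrad Y i x := by
  simp only [areaGrad, gradUp, areaDensity_congr h, metricInv_congr h, pd_congr h]

end Locality

section Reparametrization

/-- The Jacobian matrix of a map of the plane. -/
noncomputable def jacobian (φ : Plane → Plane) (x : Plane) : Matrix (Fin 2) (Fin 2) ℝ :=
  Matrix.of fun a i => pd i φ x a

lemma det_jacobian (φ : Plane → Plane) (x : Plane) : (jacobian φ x).det = (fderiv ℝ φ x).det := by
  rw [ContinuousLinearMap.det,
    ← LinearMap.det_toMatrix (EuclideanSpace.basisFun (Fin 2) ℝ).toBasis]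
  congr 1

variable {m : ℕ} {X : Plane → Ambient m} {φ : Plane → Plane} {U W : Set Plane} {x : Plane}

lemma sum_apply_smul_single (v : Plane) :
    ∑ a, v a • EuclideanSpace.single a (1 : ℝ) = v := by
  simpa using (EuclideanSpace.basisFun (Fin 2) ℝ).sum_repr v

lemma pd_comp {F : Type*} [NormedAddCommGroup F] [NormedSpace ℝ F] {f : Plane → F}
    (hf : DifferentiableAt ℝ f (φ x)) (hφ : DifferentiableAt ℝ φ x) (i : Fin 2) :
    pd i (f ∘ φ) x = ∑ a, jacobian φ x a i • pd a f (φ x) := by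
  rw [pd, fderiv_comp x hf hφ, ContinuousLinearMap.comp_apply]
  change fderiv ℝ f (φ x) (pd i φ x) = _
  conv_lhs => rw [← sum_apply_smul_single (pd i φ x)]
  simp [pd, jacobian]

/-- A smooth change of coordinates, by which an immersion of `U` becomes one of `W`. -/
structure CoordChangeOn (φ : Plane → Plane) (W U : Set Plane) : Prop where
  isOpen : IsOpen W
  contDiffOn : ContDiffOn ℝ ∞ φ W
  mapsTo : Set.MapsTo φ W U
  det_ne_zero : ∀ x ∈ W, (jacobian φ x).det ≠ 0

variable (h : ImmersionOn X U) (hφ : CoordChangeOn φ W U)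
include h hφ

lemma metric_comp (hx : x ∈ W) :
    metric (X ∘ φ) x = (jacobian φ x).transpose * metric X (φ x) * jacobian φ x := by
  have h1 := pd_comp (h.differentiableAt (hφ.mapsTo hx) h.contDiffOn)
    ((hφ.contDiffOn.contDiffAt (hφ.isOpen.mem_nhds hx)).differentiableAt (by simp))
  ext i j
  rw [← inner_pd_pd, h1, h1]
  simp only [Fin.sum_univ_two, inner_add_left, inner_add_right, inner_smul_left, inner_smul_right,
    inner_pd_pd, Matrix.mul_apply, Matrix.transpose_apply, RCLike.conj_to_real]
  ring

lemma immersionOn_comp : ImmersionOn (X ∘ φ) W where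
  isOpen := hφ.isOpen
  contDiffOn := h.contDiffOn.comp hφ.contDiffOn hφ.mapsTo
  det_pos x hx := by
    have := h.det_pos _ (hφ.mapsTo hx)
    have hJ := hφ.det_ne_zero x hx
    rw [metric_comp h hφ hx, Matrix.det_mul, Matrix.det_mul, Matrix.det_transpose]
    have : 0 < (jacobian φ x).det ^ 2 * (metric X (φ x)).det := by positivity
    linarith

lemma areaDensity_comp (hx : x ∈ W) :
    areaDensity (X ∘ φ) x = |(jacobian φ x).det| * areaDensity X (φ x) := by
  rw [areaDensity, areaDensity, metric_comp h hφ hx, Matrix.det_mul, Matrix.det_mul,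
    Matrix.det_transpose, ← Real.sqrt_sq_eq_abs, ← Real.sqrt_mul (sq_nonneg _)]
  congr 1
  ring

lemma pd_pd_comp (hx : x ∈ W) (i j : Fin 2) : pd i (pd j (X ∘ φ)) x =
    ∑ a, pd i (fun y => jacobian φ y a j) x • pd a X (φ x)
      + ∑ a, ∑ b, (jacobian φ x a i * jacobian φ x b j) • pd a (pd b X) (φ x) := by
  have hφd : ∀ y ∈ W, DifferentiableAt ℝ φ y := fun y hy =>
    (hφ.contDiffOn.contDiffAt (hφ.isOpen.mem_nhds hy)).differentiableAt (by simp)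
  have h0 : pd j (X ∘ φ) =ᶠ[nhds x] fun y => ∑ a, jacobian φ y a j • (pd a X ∘ φ) y := by
    filter_upwards [hφ.isOpen.mem_nhds hx] with y hy
    exact pd_comp (h.differentiableAt (hφ.mapsTo hy) h.contDiffOn) (hφd y hy) j
  have hJ : ∀ a, DifferentiableAt ℝ (fun y => jacobian φ y a j) x := by
    intro a
    have h1 : DifferentiableAt ℝ (pd j φ) x := ((contDiffOn_pd hφ.isOpen hφ.contDiffOn j).contDiffAt
      (hφ.isOpen.mem_nhds hx)).differentiableAt (by simp)
    exact (EuclideanSpace.proj a : Plane →L[ℝ] ℝ).differentiableAt.comp x h1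
  have hX : ∀ a, DifferentiableAt ℝ (pd a X) (φ x) := h.differentiableAt_pd (hφ.mapsTo hx)
  have hXc : ∀ a, DifferentiableAt ℝ (pd a X ∘ φ) x := fun a => (hX a).comp x (hφd x hx)
  have h1 := pd_sum (s := Finset.univ) (f := fun a y => jacobian φ y a j • (pd a X ∘ φ) y)
    (fun a _ => (hJ a).smul (hXc a)) i
  rw [pd_congr h0]
  refine h1.trans ?_
  have h2 : ∀ a, pd i (fun y => jacobian φ y a j • (pd a X ∘ φ) y) x =
      pd i (fun y => jacobian φ y a j) x • pd a X (φ x)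
        + jacobian φ x a j • ∑ b, jacobian φ x b i • pd b (pd a X) (φ x) := fun a => by
    refine (pd_smul (hJ a) (hXc a) i).trans ?_
    rw [pd_comp (hX a) (hφd x hx), Function.comp_apply]
  rw [Finset.sum_congr rfl fun a _ => h2 a]
  simp only [Fin.sum_univ_two]
  module

lemma tangentPlane_comp (hx : x ∈ W) : tangentPlane (X ∘ φ) x = tangentPlane X (φ x) := by
  have h1 := pd_comp (h.differentiableAt (hφ.mapsTo hx) h.contDiffOn)
    ((hφ.contDiffOn.contDiffAt (hφ.isOpen.mem_nhds hx)).differentiableAt (by simp))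
  have hJ := hφ.det_ne_zero x hx
  apply le_antisymm
  · rw [tangentPlane, Submodule.span_le]
    rintro _ ⟨i, rfl⟩
    simp only [h1]
    exact Submodule.sum_mem _ fun a _ => Submodule.smul_mem _ _ (pd_mem_tangentPlane X _ a)
  · rw [tangentPlane, Submodule.span_le]
    rintro _ ⟨a, rfl⟩
    have h2 : pd a X (φ x) = ∑ i, (jacobian φ x)⁻¹ i a • pd i (X ∘ φ) x := by
      simp only [h1, Finset.smul_sum, smul_smul]
      rw [Finset.sum_comm]
      simp only [← Finset.sum_smul, mul_comm _ (jacobian φ x _ _), ← Matrix.mul_apply,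
        Matrix.mul_nonsing_inv _ (isUnit_iff_ne_zero.2 hJ), Matrix.one_apply]
      simp
    simp only [h2]
    exact Submodule.sum_mem _ fun i _ => Submodule.smul_mem _ _ (pd_mem_tangentPlane _ _ i)

lemma normalProj_comp (hx : x ∈ W) (v : Ambient m) :
    normalProj (X ∘ φ) x v = normalProj X (φ x) v := by
  have key : ∀ {S T : Submodule ℝ (Ambient m)}, S = T →
      Sᗮ.starProjection v = Tᗮ.starProjection v := by
    rintro S _ rfl; rfl
  exact key (tangentPlane_comp h hφ hx)

omit hφ in
lemma ImmersionOn.secondFF_eq_normalProj (hx : x ∈ U) (i j : Fin 2) :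
    secondFF X i j x = normalProj X x (pd i (pd j X) x) := by
  have hz : ∀ k, (tangentPlane X x)ᗮ.starProjection (pd k X x) = 0 := normalProj_pd X x
  have hs : (tangentPlane X x)ᗮ.starProjection (secondFF X i j x) = secondFF X i j x :=
    normalProj_of_inner_pd_eq_zero X x (h.inner_secondFF_pd hx i j)
  rw [pd_pd_eq, normalProj]
  simp only [map_add, map_sum, map_smul, hz, hs, smul_zero, Finset.sum_const_zero, add_zero]

/-- The second fundamental form is the normal part of the second coordinate derivatives. The terms
containing second derivatives of `φ` are tangential, and the normal space is the same in both
parametrizations. -/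
lemma secondFF_comp (hx : x ∈ W) (i j : Fin 2) : secondFF (X ∘ φ) i j x =
    ∑ a, ∑ b, (jacobian φ x a i * jacobian φ x b j) • secondFF X a b (φ x) := by
  have hz : ∀ k, (tangentPlane X (φ x))ᗮ.starProjection (pd k X (φ x)) = 0 :=
    normalProj_pd X (φ x)
  rw [(immersionOn_comp h hφ).secondFF_eq_normalProj hx, pd_pd_comp h hφ hx,
    normalProj_comp h hφ hx, normalProj]
  simp only [map_add, map_sum, map_smul, hz, smul_zero, Finset.sum_const_zero, zero_add,
    h.secondFF_eq_normalProj (hφ.mapsTo hx), normalProj]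

/-- The mean curvature vector does not depend on the parametrization. -/
lemma meanCurvature_comp (hx : x ∈ W) : meanCurvature (X ∘ φ) x = meanCurvature X (φ x) := by
  have hJ := isUnit_iff_ne_zero.2 (hφ.det_ne_zero x hx)
  -- The inverse metric transforms contravariantly, so the Jacobians cancel in the trace of the
  -- second fundamental form.
  have h1 : metricInv X (φ x) = jacobian φ x * metricInv (X ∘ φ) x * (jacobian φ x).transpose := by
    have hJt : IsUnit (jacobian φ x).transpose.det := by rwa [Matrix.det_transpose]
    rw [metricInv, metricInv, metric_comp h hφ hx, Matrix.mul_inv_rev, Matrix.mul_inv_rev,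
      Matrix.mul_nonsing_inv_cancel_left _ _ hJ, Matrix.nonsing_inv_mul_cancel_right _ _ hJt]
  rw [meanCurvature, meanCurvature, h1]
  congr 1
  simp only [secondFF_comp h hφ hx, Matrix.mul_apply, Matrix.transpose_apply, Fin.sum_univ_two]
  module

theorem energyDensity_comp (hx : x ∈ W) : energyDensity (X ∘ φ) x =
    |(fderiv ℝ φ x).det| * energyDensity X (φ x) := by
  rw [energyDensity, energyDensity, meanCurvature_comp h hφ hx, areaDensity_comp h hφ hx,
    det_jacobian]
  ring

end Reparametrization

end Willmore

/-! ### The first variation as a density: flux, additivity and coordinate changes -/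

namespace Willmore

/-- The first variation of the Willmore energy density of `X` in the direction `V`. -/
noncomputable def firstVariation {m : ℕ} (X V : Plane → Ambient m) (x : Plane) : ℝ :=
  deriv (fun t : ℝ => energyDensity (fun y => X y + t • V y) x) 0

namespace ImmersionFamilyOn

variable {P : Type*} [NormedAddCommGroup P] [NormedSpace ℝ P] {F : Type*} [NormedAddCommGroup F]
  [NormedSpace ℝ F] {m : ℕ}
  {f : P × Plane → Ambient m} {Ω : Set (P × Plane)} (h : ImmersionFamilyOn f Ω) {q : P × Plane}
include h

lemma hasDerivAt_param (hq : q ∈ Ω) {u : P × Plane → F} (hu : ContDiffOn ℝ ∞ u Ω) (v : P) :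
    HasDerivAt (fun t : ℝ => u (q.1 + t • v, q.2)) (fderiv ℝ u q (v, 0)) 0 := by
  have h1 : HasDerivAt (fun t : ℝ => (q.1 + t • v, q.2)) (v, (0 : Plane)) 0 := by
    have := (((hasDerivAt_id (0 : ℝ)).smul_const v).const_add q.1).prodMk
      (hasDerivAt_const (0 : ℝ) q.2)
    simpa using this
  have h2 : HasFDerivAt u (fderiv ℝ u q) (q.1 + (0 : ℝ) • v, q.2) := by
    simpa using (h.differentiableAt hq hu).hasFDerivAt
  exact h2.comp_hasDerivAt (0 : ℝ) h1

end ImmersionFamilyOn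

namespace ImmersionOn

variable {m : ℕ} {X V V' : Plane → Ambient m} {U : Set Plane} {x : Plane} (h : ImmersionOn X U)
  (hV : ContDiffOn ℝ ∞ V U)
include h hV

/-- The immersed members of the linear variation `X + t V`. -/
lemma linearFamily : ImmersionFamilyOn (fun q : ℝ × Plane => X q.2 + q.1 • V q.2)
    ((Set.univ ×ˢ U) ∩ {q | 0 < (metric (fun y => X y + q.1 • V y) q.2).det}) :=
  immersionFamilyOn_of_contDiffOn (f := fun q : ℝ × Plane => X q.2 + q.1 • V q.2)
    (isOpen_univ.prod h.isOpen) ((contDiffOn_const_slice h.contDiffOn).add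
      (contDiffOn_fst.smul (contDiffOn_const_slice hV)))

omit hV in
lemma mem_linearFamily (V : Plane → Ambient m) (hx : x ∈ U) : ((0 : ℝ), x) ∈
    (Set.univ ×ˢ U) ∩ {q : ℝ × Plane | 0 < (metric (fun y => X y + q.1 • V y) q.2).det} := by
  refine ⟨⟨Set.mem_univ _, hx⟩, ?_⟩
  simpa using h.det_pos x hx

lemma hasDerivAt_energyDensity (hx : x ∈ U) :
    HasDerivAt (fun t : ℝ => energyDensity (fun y => X y + t • V y) x) (firstVariation X V x) 0 := by
  have hF := h.linearFamily hV
  have := hF.hasDerivAt_param (h.mem_linearFamily V hx) hF.contDiffOn_energyDensity (1 : ℝ)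
  simp only [zero_add, smul_eq_mul, mul_one] at this
  exact this.differentiableAt.hasDerivAt

lemma firstVariation_eq (hx : x ∈ U) : firstVariation X V x = fderiv ℝ (fun q : ℝ × Plane =>
    energyDensity (fun y => X y + q.1 • V y) q.2) (0, x) (1, 0) := by
  have hF := h.linearFamily hV
  have := hF.hasDerivAt_param (h.mem_linearFamily V hx) hF.contDiffOn_energyDensity (1 : ℝ)
  simp only [zero_add, smul_eq_mul, mul_one] at this
  exact this.deriv

lemma continuousOn_firstVariation : ContinuousOn (firstVariation X V) U := by
  have hF := h.linearFamily hV
  have h1 := ImmersionFamilyOn.contDiffOn_slice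
    (hF.contDiffOn_fderiv_param hF.contDiffOn_energyDensity (1, 0)) (0 : ℝ)
  refine (h1.continuousOn.mono fun x hx => h.mem_linearFamily V hx).congr fun x hx => ?_
  exact h.firstVariation_eq hV hx

/-- The first variation formula, with an unspecified flux `Z` depending locally on `V`. -/
theorem exists_flux : ∃ Z : Fin 2 → Plane → ℝ, (∀ i, ContDiffOn ℝ ∞ (Z i) U) ∧
    (∀ i, ∀ y ∈ U, V =ᶠ[nhds y] 0 → Z i y = 0) ∧
    ∀ x ∈ U, firstVariation X V x = ∑ i, pd i (Z i) x
      - areaDensity X x * inner ℝ (covDiv X (stress X) x) (V x) := by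
  have hF := h.linearFamily hV
  have hmem : ∀ y ∈ U, _ := fun y hy => h.mem_linearFamily V hy
  have hvel : ∀ y ∈ U, fderiv ℝ (fun q : ℝ × Plane => X q.2 + q.1 • V q.2) (0, y) (1, 0) = V y := by
    intro y hy
    have h1 := hF.hasDerivAt_param (hmem y hy) hF.contDiffOn (1 : ℝ)
    have h2 : HasDerivAt (fun t : ℝ => X y + t • V y) (V y) 0 := by
      simpa using ((hasDerivAt_id (0 : ℝ)).smul_const (V y)).const_add (X y)
    simp only [zero_add, smul_eq_mul, mul_one] at h1
    exact h1.unique h2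
  -- The flux is `Z^i = H · δ(√g ∇^i X) + √g T^i · V`, as read off from the first variation formula.
  refine ⟨fun i y => inner ℝ (meanCurvature X y) (fderiv ℝ (fun r : ℝ × Plane =>
      areaGrad (fun z => X z + r.1 • V z) i r.2) (0, y) (1, 0))
    + inner ℝ (areaDensity X y • stress X i y) (V y), fun i => ?_, fun i y hy hVy => ?_,
    fun x hx => ?_⟩
  · refine (h.contDiffOn_meanCurvature.inner ℝ ?_).add
      ((h.contDiffOn_areaDensity.smul (h.contDiffOn_stress i)).inner ℝ hV)
    exact (ImmersionFamilyOn.contDiffOn_slice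
      (hF.contDiffOn_fderiv_param (hF.contDiffOn_areaGrad i) (1, 0)) (0 : ℝ)).mono hmem
  -- If `V` vanishes near `y`, the family does not depend on `t` there, so `δ(√g ∇^i X)` vanishes at
  -- `y` as well.
  · have h1 := hF.hasDerivAt_param (hmem y hy) (hF.contDiffOn_areaGrad i) (1 : ℝ)
    simp only [zero_add, smul_eq_mul, mul_one] at h1
    have h2 : (fun t : ℝ => areaGrad (fun z => X z + t • V z) i y) = fun _ => areaGrad X i y := by
      funext t
      refine areaGrad_congr ?_ i
      filter_upwards [hVy] with z hz
      simp [hz]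
    rw [h2] at h1
    beta_reduce
    rw [h1.unique (hasDerivAt_const _ _), hVy.eq_of_nhds]
    simp
  · rw [h.firstVariation_eq hV hx, hF.fderiv_energyDensity (hmem x hx) (1 : ℝ)]
    simp only [zero_smul, add_zero]
    rw [hvel x hx]
    congr 1
    refine Finset.sum_congr rfl fun i _ => pd_congr ?_ i
    filter_upwards [h.isOpen.mem_nhds hx] with y hy
    rw [hvel y hy]

/-- A derivative along a curve is not additive in its direction by itself. The two-parameter family
`X + s V + s' V'` is jointly smooth, and its derivative in the direction `(1, 1)` is the sum of
those in `(1, 0)` and `(0, 1)`. -/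
lemma firstVariation_add (hV' : ContDiffOn ℝ ∞ V' U) (hx : x ∈ U) :
    firstVariation X (fun y => V y + V' y) x = firstVariation X V x + firstVariation X V' x := by
  have hc : ContDiffOn ℝ ∞
      (fun q : (ℝ × ℝ) × Plane => X q.2 + (q.1.1 • V q.2 + q.1.2 • V' q.2)) (Set.univ ×ˢ U) := by
    have hs : ∀ {f : Plane → Ambient m}, ContDiffOn ℝ ∞ f U →
        ContDiffOn ℝ ∞ (fun q : (ℝ × ℝ) × Plane => f q.2) (Set.univ ×ˢ U) :=
      fun hf => hf.comp contDiffOn_snd fun _ hq => hq.2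
    exact (hs h.contDiffOn).add (((contDiff_fst.comp contDiff_fst).contDiffOn.smul (hs hV)).add
      ((contDiff_snd.comp contDiff_fst).contDiffOn.smul (hs hV')))
  have hF := immersionFamilyOn_of_contDiffOn (isOpen_univ.prod h.isOpen) hc
  have hmem : ((0 : ℝ × ℝ), x) ∈ (Set.univ ×ˢ U) ∩ {q : (ℝ × ℝ) × Plane |
      0 < (metric (fun y => X y + (q.1.1 • V y + q.1.2 • V' y)) q.2).det} := by
    refine ⟨⟨Set.mem_univ _, hx⟩, ?_⟩
    simpa using h.det_pos x hx
  have key := fun v : ℝ × ℝ => (hF.hasDerivAt_param hmem hF.contDiffOn_energyDensity v).deriv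
  have h1 := key (1, 1)
  have h2 := key (1, 0)
  have h3 := key (0, 1)
  simp only [zero_add, Prod.smul_mk, smul_eq_mul, mul_one, mul_zero, zero_smul, add_zero,
    ← smul_add] at h1 h2 h3
  rw [firstVariation, firstVariation, firstVariation, h1, h2, h3, ← map_add]
  simp

omit h hV in
lemma firstVariation_of_eventuallyEq_zero (hVx : V =ᶠ[nhds x] 0) : firstVariation X V x = 0 := by
  have : (fun t : ℝ => energyDensity (fun y => X y + t • V y) x) = fun _ => energyDensity X x := by
    funext t
    refine energyDensity_congr ?_
    filter_upwards [hVx] with z hz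
    simp [hz]
  rw [firstVariation, this, deriv_const]

omit h hV in
lemma firstVariation_congr {X' : Plane → Ambient m} (hX : X =ᶠ[nhds x] X')
    (hVV : V =ᶠ[nhds x] V') : firstVariation X V x = firstVariation X' V' x := by
  rw [firstVariation, firstVariation]
  congr 1
  funext t
  refine energyDensity_congr ?_
  filter_upwards [hX, hVV] with z hz hz'
  rw [hz, hz']

omit hV in
lemma firstVariation_sum {ι : Type*} (s : Finset ι) {W : ι → Plane → Ambient m}
    (hW : ∀ k ∈ s, ContDiffOn ℝ ∞ (W k) U) (hx : x ∈ U) :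
    firstVariation X (fun y => ∑ k ∈ s, W k y) x = ∑ k ∈ s, firstVariation X (W k) x := by
  classical
  induction s using Finset.induction_on with
  | empty =>
    simp only [Finset.sum_empty]
    exact firstVariation_of_eventuallyEq_zero Filter.EventuallyEq.rfl
  | insert a s ha ih =>
    simp only [Finset.sum_insert ha]
    have hs : ∀ k ∈ s, ContDiffOn ℝ ∞ (W k) U := fun k hk => hW k (Finset.mem_insert_of_mem hk)
    rw [h.firstVariation_add (hW a (Finset.mem_insert_self a s))
      (ContDiffOn.sum fun k hk => hs k hk) hx, ih hs]

/-- The first variation is a density: it does not depend on the parametrization. -/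
theorem firstVariation_comp {φ : Plane → Plane} {W : Set Plane} (hφ : CoordChangeOn φ W U)
    (hx : x ∈ W) :
    firstVariation (X ∘ φ) (V ∘ φ) x = |(fderiv ℝ φ x).det| * firstVariation X V (φ x) := by
  have hF := h.linearFamily hV
  have h1 : ∀ᶠ t : ℝ in nhds 0, energyDensity (fun y => (X ∘ φ) y + t • (V ∘ φ) y) x =
      |(fderiv ℝ φ x).det| * energyDensity (fun y => X y + t • V y) (φ x) := by
    -- For small `t` the map `X + t V` is still an immersion near `φ x`, so the transformation rule
    -- of the energy density applies to it.
    have h0 : ∀ᶠ t : ℝ in nhds 0, (t, φ x) ∈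
        (Set.univ ×ˢ U) ∩ {q : ℝ × Plane | 0 < (metric (fun y => X y + q.1 • V y) q.2).det} :=
      (Continuous.prodMk_left (φ x)).continuousAt.eventually
        (hF.isOpen.mem_nhds (h.mem_linearFamily V (hφ.mapsTo hx)))
    filter_upwards [h0] with t ht
    obtain ⟨Ut, hUt, hxt⟩ : ∃ Ut, ImmersionOn (fun y => X y + t • V y) Ut ∧ φ x ∈ Ut :=
      ⟨_, hF.immersionOn_slice t, ht⟩
    have hφ' : CoordChangeOn φ (W ∩ φ ⁻¹' Ut) Ut :=
      { isOpen := hφ.contDiffOn.continuousOn.isOpen_inter_preimage hφ.isOpen hUt.isOpen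
        contDiffOn := hφ.contDiffOn.mono Set.inter_subset_left
        mapsTo := fun y hy => hy.2
        det_ne_zero := fun y hy => hφ.det_ne_zero y hy.1 }
    have h2 := energyDensity_comp hUt hφ' ⟨hx, hxt⟩
    rw [← h2]
    rfl
  rw [firstVariation, Filter.EventuallyEq.deriv_eq h1,
    deriv_const_mul _ (h.hasDerivAt_energyDensity hV (hφ.mapsTo hx)).differentiableAt,
    firstVariation]

end ImmersionOn

end Willmore

/-! ### Integration by parts and differentiation under the integral in the plane -/

namespace Willmore

open MeasureTheory Set

section Analysis

variable {F : Type*} [NormedAddCommGroup F] [NormedSpace ℝ F] {U K : Set Plane}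

lemma contDiff_indicator (hU : IsOpen U) (hK : IsClosed K) (hKU : K ⊆ U) {Z : Plane → F}
    (hZ : ContDiffOn ℝ ∞ Z U) (hZK : ∀ x ∈ U, x ∉ K → Z x = 0) :
    ContDiff ℝ ∞ (U.indicator Z) := by
  rw [contDiff_iff_contDiffAt]
  intro x
  by_cases hx : x ∈ U
  · refine (hZ.contDiffAt (hU.mem_nhds hx)).congr_of_eventuallyEq ?_
    filter_upwards [hU.mem_nhds hx] with y hy using indicator_of_mem hy Z
  · have hxK : x ∈ Kᶜ := fun h => hx (hKU h)
    refine contDiffAt_const (c := (0 : F)) |>.congr_of_eventuallyEq ?_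
    filter_upwards [hK.isOpen_compl.mem_nhds hxK] with y hy
    by_cases hyU : y ∈ U
    · rw [indicator_of_mem hyU, hZK y hyU hy]
    · exact indicator_of_notMem hyU Z

lemma integral_pd_of_hasCompactSupport {Z : Plane → ℝ} (hZ : ContDiff ℝ 1 Z)
    (hc : HasCompactSupport Z) (i : Fin 2) : ∫ x, pd i Z x = 0 := by
  have hd : Continuous (fun x => fderiv ℝ Z x (EuclideanSpace.single i (1 : ℝ))) :=
    (hZ.continuous_fderiv one_ne_zero).clm_apply continuous_const
  have hdc : HasCompactSupport (fun x => fderiv ℝ Z x (EuclideanSpace.single i (1 : ℝ))) :=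
    hc.fderiv_apply (𝕜 := ℝ) _
  -- Integration by parts against the constant function 1.
  have := integral_mul_fderiv_eq_neg_fderiv_mul_of_integrable (μ := (volume : Measure Plane))
    (f := fun _ : Plane => (1 : ℝ)) (g := Z) (v := EuclideanSpace.single i (1 : ℝ))
    (by simp) (by simpa using hd.integrable_of_hasCompactSupport hdc)
    (by simpa using hZ.continuous.integrable_of_hasCompactSupport hc)
    (by fun_prop) (fun x _ => hZ.differentiable one_ne_zero x)
  simpa [pd] using this

/-- The divergence theorem for functions with compact support in an open set. -/
lemma setIntegral_pd_eq_zero (hU : IsOpen U) (hK : IsCompact K) (hKU : K ⊆ U) {Z : Plane → ℝ}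
    (hZ : ContDiffOn ℝ ∞ Z U) (hZK : ∀ x ∈ U, x ∉ K → Z x = 0) (i : Fin 2) :
    ∫ x in U, pd i Z x = 0 := by
  have h1 := contDiff_indicator hU hK.isClosed hKU hZ hZK
  have hc : HasCompactSupport (U.indicator Z) := by
    refine HasCompactSupport.intro hK fun x hx => ?_
    by_cases hxU : x ∈ U
    · rw [indicator_of_mem hxU, hZK x hxU hx]
    · exact indicator_of_notMem hxU Z
  rw [← integral_pd_of_hasCompactSupport (h1.of_le (by simp)) hc i,
    ← integral_indicator hU.measurableSet]
  refine integral_congr_ae (Filter.Eventually.of_forall fun x => ?_)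
  by_cases hx : x ∈ U
  · change U.indicator (fun x => pd i Z x) x = pd i (U.indicator Z) x
    rw [indicator_of_mem hx]
    refine pd_congr ?_ i
    filter_upwards [hU.mem_nhds hx] with y hy using (indicator_of_mem hy Z).symm
  · change U.indicator (fun x => pd i Z x) x = pd i (U.indicator Z) x
    rw [indicator_of_notMem hx]
    have : U.indicator Z =ᶠ[nhds x] fun _ => (0 : ℝ) := by
      filter_upwards [hK.isClosed.isOpen_compl.mem_nhds fun h => hx (hKU h)] with y hy
      by_cases hyU : y ∈ U
      · rw [indicator_of_mem hyU, hZK y hyU hy]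
      · exact indicator_of_notMem hyU Z
    rw [pd_congr this i]
    simp [pd]

lemma integrableOn_of_compact_support (hU : MeasurableSet U) (hK : IsCompact K) (hKU : K ⊆ U)
    {w : Plane → ℝ} (hw : ContinuousOn w U) (hwK : ∀ x ∈ U, x ∉ K → w x = 0) :
    IntegrableOn w U := by
  have h1 : IntegrableOn w K := (hw.mono hKU).integrableOn_compact hK
  exact h1.of_forall_sdiff_eq_zero hU fun x hx => hwK x hx.1 hx.2

/-- Differentiation under the integral sign over a compact set. -/
lemma hasDerivAt_setIntegral {Ω : Set (ℝ × Plane)} (hΩ : IsOpen Ω) (hK : IsCompact K)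
    (hKΩ : ∀ x ∈ K, ((0 : ℝ), x) ∈ Ω) {u : ℝ × Plane → ℝ} (hu : ContDiffOn ℝ ∞ u Ω)
    {w : Plane → ℝ} (hw : ContinuousOn w K) :
    HasDerivAt (fun t : ℝ => ∫ x in K, w x * u (t, x))
      (∫ x in K, w x * fderiv ℝ u (0, x) (1, 0)) 0 := by
  -- Compactness of `K` gives a time interval on which all of `K` stays in `Ω`; the derivative is
  -- then bounded on the product with a smaller closed interval, and that bound dominates.
  obtain ⟨I, J, hI, hJ, h0I, hKJ, hIJ⟩ := generalized_tube_lemma isCompact_singleton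
    hK hΩ (fun q hq => by
      obtain ⟨t, x⟩ := q
      obtain ⟨rfl, hx⟩ := hq
      exact hKΩ x hx)
  obtain ⟨ε, hε, hεI⟩ := Metric.isOpen_iff.1 hI 0 (h0I rfl)
  have hsub : Metric.closedBall (0 : ℝ) (ε / 2) ×ˢ K ⊆ Ω := fun q hq =>
    hIJ ⟨hεI (Metric.closedBall_subset_ball (half_lt_self hε) hq.1), hKJ hq.2⟩
  have hu' : ContinuousOn (fun q => fderiv ℝ u q (1, 0)) Ω :=
    ((hu.fderiv_of_isOpen hΩ (m := ∞) le_rfl).clm_apply contDiffOn_const).continuousOn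
  have hslice : ∀ {v : ℝ × Plane → ℝ}, ContinuousOn v Ω → ∀ t ∈ Metric.closedBall (0 : ℝ) (ε / 2),
      ContinuousOn (fun x => w x * v (t, x)) K := fun hv t ht =>
    hw.mul (hv.comp (Continuous.prodMk_right t).continuousOn fun x hx => hsub ⟨ht, hx⟩)
  have h0 : (0 : ℝ) ∈ Metric.closedBall (0 : ℝ) (ε / 2) := Metric.mem_closedBall_self (by linarith)
  obtain ⟨C, hC⟩ := ((isCompact_closedBall (0 : ℝ) (ε / 2)).prod hK).exists_bound_of_continuousOn
    (f := fun q : ℝ × Plane => w q.2 * fderiv ℝ u q (1, 0))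
    ((hw.comp continuousOn_snd fun q hq => hq.2).mul (hu'.mono hsub))
  have hnhds : Metric.closedBall (0 : ℝ) (ε / 2) ∈ nhds (0 : ℝ) :=
    Metric.closedBall_mem_nhds _ (by linarith)
  refine (hasDerivAt_integral_of_dominated_loc_of_deriv_le (μ := volume.restrict K)
    (bound := fun _ => C) (F := fun t x => w x * u (t, x))
    (F' := fun t x => w x * fderiv ℝ u (t, x) (1, 0)) hnhds ?_ ?_ ?_ ?_ ?_ ?_).2
  · filter_upwards [hnhds] with t ht
    exact (hslice hu.continuousOn t ht).aestronglyMeasurable hK.measurableSet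
  · exact (hslice hu.continuousOn 0 h0).integrableOn_compact hK
  · exact (hslice hu' 0 h0).aestronglyMeasurable hK.measurableSet
  · filter_upwards [ae_restrict_mem hK.measurableSet] with x hx t ht
    exact hC (t, x) ⟨ht, hx⟩
  · exact integrableOn_const hK.measure_lt_top.ne
  · filter_upwards [ae_restrict_mem hK.measurableSet] with x hx t ht
    have h1 : HasFDerivAt u (fderiv ℝ u (t, x)) (t, x) :=
      ((hu.contDiffAt (hΩ.mem_nhds (hsub ⟨ht, hx⟩))).differentiableAt (by simp)).hasFDerivAt
    have h2 : HasDerivAt (fun s : ℝ => (s, x)) ((1 : ℝ), (0 : Plane)) t :=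
      (hasDerivAt_id t).prodMk (hasDerivAt_const t x)
    exact (h1.comp_hasDerivAt t h2).const_mul (w x)

end Analysis

end Willmore

/-! ### Immersions read in charts and transition maps -/

namespace Willmore

/-- With `a` and `b` the two frame vectors, linear independence makes `|b|² a - (a · b) b` nonzero,
and its squared norm is `|b|²` times the Gram determinant. -/
lemma det_metric_pos {m : ℕ} {X : Plane → Ambient m} {x : Plane}
    (hinj : Function.Injective (fderiv ℝ X x)) : 0 < (metric X x).det := by
  have hne : ∀ v : Plane, v ≠ 0 → fderiv ℝ X x v ≠ 0 := fun v hv h0 =>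
    hv (hinj (h0.trans (map_zero _).symm))
  have hb : pd 1 X x ≠ 0 := hne _ (by simp)
  have hbb : 0 < inner ℝ (pd 1 X x) (pd 1 X x) := real_inner_self_pos.2 hb
  have hw : inner ℝ (pd 1 X x) (pd 1 X x) • pd 0 X x
      - inner ℝ (pd 0 X x) (pd 1 X x) • pd 1 X x ≠ 0 := by
    have := hne (inner ℝ (pd 1 X x) (pd 1 X x) • EuclideanSpace.single 0 (1 : ℝ)
      - inner ℝ (pd 0 X x) (pd 1 X x) • EuclideanSpace.single 1 (1 : ℝ)) fun h0 => by
        have := congrArg (fun v : Plane => v 0) h0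
        simp at this
        exact hb this
    simpa [pd] using this
  have hpos := real_inner_self_pos.2 hw
  rw [Matrix.det_fin_two, metric_comm X x 1 0]
  simp only [← inner_pd_pd]
  simp only [inner_sub_left, inner_sub_right, inner_smul_left, inner_smul_right,
    RCLike.conj_to_real, real_inner_comm (pd 0 X x) (pd 1 X x)] at hpos
  refine pos_of_mul_pos_right (a := inner ℝ (pd 1 X x) (pd 1 X x)) ?_ hbb.le
  linarith

section Charts

variable {S : Type*} [TopologicalSpace S] [ChartedSpace Plane S] {m : ℕ}
  {e e' : OpenPartialHomeomorph S Plane}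

lemma contDiffOn_comp_symm {F : Type*} [NormedAddCommGroup F] [NormedSpace ℝ F] {f : S → F}
    (hf : ContMDiff (𝓡 2) 𝓘(ℝ, F) ∞ f) (he : e ∈ IsManifold.maximalAtlas (𝓡 2) ∞ S) :
    ContDiffOn ℝ ∞ (f ∘ e.symm) e.target :=
  contMDiffOn_iff_contDiffOn.1
    (hf.comp_contMDiffOn (contMDiffOn_symm_of_mem_maximalAtlas he))

lemma IsSmoothImmersion.immersionOn [IsManifold (𝓡 2) ∞ S] {Φ : S → Ambient m} (hΦ : IsSmoothImmersion Φ)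
    (he : e ∈ IsManifold.maximalAtlas (𝓡 2) ∞ S) : ImmersionOn (Φ ∘ e.symm) e.target where
  isOpen := e.open_target
  contDiffOn := contDiffOn_comp_symm hΦ.1 he
  det_pos x hx := by
    apply det_metric_pos
    have hm : e.MDifferentiable (𝓡 2) (𝓡 2) :=
      ⟨(contMDiffOn_of_mem_maximalAtlas he).mdifferentiableOn (by simp),
        (contMDiffOn_symm_of_mem_maximalAtlas he).mdifferentiableOn (by simp)⟩
    have h1 : Function.Injective (mfderiv (𝓡 2) (𝓡 2) e.symm x) :=
      hm.symm.mfderiv_injective hx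
    have h2 := mfderiv_comp x (hΦ.1.mdifferentiable (by simp) (e.symm x))
      (hm.mdifferentiableAt_symm hx)
    rw [← mfderiv_eq_fderiv, h2]
    exact (hΦ.2 (e.symm x)).comp h1

/-- The transition map between two charts is a change of coordinates. -/
lemma coordChangeOn_transition (he : e ∈ IsManifold.maximalAtlas (𝓡 2) ∞ S)
    (he' : e' ∈ IsManifold.maximalAtlas (𝓡 2) ∞ S) :
    CoordChangeOn (e ∘ e'.symm) (e'.target ∩ e'.symm ⁻¹' e.source) e.target := by
  have hsmooth : ∀ {e e' : OpenPartialHomeomorph S Plane},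
      e ∈ IsManifold.maximalAtlas (𝓡 2) ∞ S → e' ∈ IsManifold.maximalAtlas (𝓡 2) ∞ S →
      ContDiffOn ℝ ∞ (e ∘ e'.symm) (e'.target ∩ e'.symm ⁻¹' e.source) := fun he he' =>
    contMDiffOn_iff_contDiffOn.1 ((contMDiffOn_of_mem_maximalAtlas he).comp
      ((contMDiffOn_symm_of_mem_maximalAtlas he').mono Set.inter_subset_left) fun _ hx => hx.2)
  have hopen : ∀ e e' : OpenPartialHomeomorph S Plane,
      IsOpen (e'.target ∩ e'.symm ⁻¹' e.source) := fun e e' =>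
    e'.isOpen_inter_preimage_symm e.open_source
  have hdiff : ∀ {e e' : OpenPartialHomeomorph S Plane},
      e ∈ IsManifold.maximalAtlas (𝓡 2) ∞ S → e' ∈ IsManifold.maximalAtlas (𝓡 2) ∞ S →
      ∀ x ∈ e'.target ∩ e'.symm ⁻¹' e.source, DifferentiableAt ℝ (e ∘ e'.symm) x :=
    fun he he' x hx => ((hsmooth he he').contDiffAt
      ((hopen _ _).mem_nhds hx)).differentiableAt (by simp)
  refine ⟨hopen e e', hsmooth he he', fun x hx => e.map_source hx.2, fun x hx h0 => ?_⟩
  have hy : (e ∘ e'.symm) x ∈ e.target ∩ e.symm ⁻¹' e'.source := by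
    refine ⟨e.map_source hx.2, ?_⟩
    simpa [e.left_inv hx.2] using e'.map_target hx.1
  -- The two transition maps are mutually inverse, so by the chain rule their Jacobian determinants
  -- have product 1.
  have h1 : (e' ∘ e.symm) ∘ (e ∘ e'.symm) =ᶠ[nhds x] id := by
    filter_upwards [(hopen e e').mem_nhds hx] with y hy
    simp [e.left_inv hy.2, e'.right_inv hy.1]
  have h2 := h1.fderiv_eq (𝕜 := ℝ)
  rw [fderiv_comp x (hdiff he' he _ hy) (hdiff he he' x hx), fderiv_id] at h2
  have h3 := congrArg ContinuousLinearMap.det h2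
  rw [det_jacobian] at h0
  have h4 : ((fderiv ℝ (e' ∘ e.symm) ((e ∘ e'.symm) x)).comp (fderiv ℝ (e ∘ e'.symm) x)).det =
      (fderiv ℝ (e' ∘ e.symm) ((e ∘ e'.symm) x)).det * (fderiv ℝ (e ∘ e'.symm) x).det := by
    simp only [ContinuousLinearMap.det, ContinuousLinearMap.toLinearMap_comp, LinearMap.det_comp]
  rw [h4, h0, mul_zero] at h3
  simp [ContinuousLinearMap.det] at h3

end Charts

end Willmore

/-! ### Differentiating the energy through a partition of unity -/

namespace Willmore

open MeasureTheory Set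

section Global

variable {S : Type*} [TopologicalSpace S] {m : ℕ}

lemma isCompact_target_inter {e : OpenPartialHomeomorph S Plane} {C : Set S} (hC : IsCompact C)
    (hCe : C ⊆ e.source) : IsCompact (e.target ∩ e.symm ⁻¹' C) := by
  rw [← e.image_eq_target_inter_inv_preimage hCe]
  exact hC.image_of_continuousOn (e.continuousOn.mono hCe)

lemma measurableSet_target_inter {e : OpenPartialHomeomorph S Plane} {C : Set S}
    (hC : IsClosed C) : MeasurableSet (e.target ∩ e.symm ⁻¹' C) := by
  have : e.target ∩ e.symm ⁻¹' C = e.target \ (e.target ∩ e.symm ⁻¹' Cᶜ) := by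
    ext x; simp +contextual
  rw [this]
  exact e.open_target.measurableSet.diff
    (e.isOpen_inter_preimage_symm hC.isOpen_compl).measurableSet

lemma comp_symm_eventuallyEq_zero {F : Type*} [Zero F] {e : OpenPartialHomeomorph S Plane}
    {V : S → F} {x : Plane} (hx : x ∈ e.target) (hV : e.symm x ∉ tsupport V) :
    V ∘ e.symm =ᶠ[nhds x] 0 := by
  have h1 : (tsupport V)ᶜ ∈ nhds (e.symm x) := (isClosed_tsupport V).isOpen_compl.mem_nhds hV
  filter_upwards [(e.continuousAt_symm hx).preimage_mem_nhds h1] with y hy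
  exact image_eq_zero_of_notMem_tsupport (f := V) hy

lemma firstVariation_chart_eq_zero {Φ V : S → Ambient m} {e : OpenPartialHomeomorph S Plane} {x : Plane}
    (hx : x ∈ e.target) (h : e.symm x ∉ tsupport V) :
    firstVariation (Φ ∘ e.symm) (V ∘ e.symm) x = 0 :=
  ImmersionOn.firstVariation_of_eventuallyEq_zero (comp_symm_eventuallyEq_zero hx h)

variable [ChartedSpace Plane S]

/-- A compactly supported function meets the supports of only finitely many members of a partition
of unity. -/
lemma exists_finset_partition (ρ : SmoothPartitionOfUnity S (𝓡 2) S univ) {K : Set S}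
    (hK : IsCompact K) : ∃ s : Finset S, ∀ p ∉ s, ∀ x ∈ K, ρ p x = 0 := by
  have hfin := ρ.locallyFinite.finite_nonempty_inter_compact hK
  refine ⟨hfin.toFinset, fun p hp x hx => ?_⟩
  by_contra h
  exact hp (hfin.mem_toFinset.2 ⟨x, h, hx⟩)

lemma sum_partition_eq_one (ρ : SmoothPartitionOfUnity S (𝓡 2) S univ) {K : Set S} {s : Finset S}
    (hs : ∀ p ∉ s, ∀ x ∈ K, ρ p x = 0) {x : S} (hx : x ∈ K) : ∑ p ∈ s, ρ p x = 1 := by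
  rw [← ρ.sum_eq_one (mem_univ x)]
  refine (finsum_eq_sum_of_support_subset _ fun p hp => ?_).symm
  by_contra h
  exact hp (hs p h x hx)

lemma continuousOn_partition_comp_symm (ρ : SmoothPartitionOfUnity S (𝓡 2) S univ) (p : S)
    (e : OpenPartialHomeomorph S Plane) : ContinuousOn (fun x => ρ p (e.symm x)) e.target :=
  (ρ p).contMDiff.continuous.comp_continuousOn e.continuousOn_symm

variable [IsManifold (𝓡 2) ∞ S] {Φ V : S → Ambient m}
  {ρ : SmoothPartitionOfUnity S (𝓡 2) S univ}

lemma chart_mem (p : S) : chartAt Plane p ∈ IsManifold.maximalAtlas (𝓡 2) ∞ S :=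
  IsManifold.chart_mem_maximalAtlas p

variable (hΦ : IsSmoothImmersion Φ) (hV : ContMDiff (𝓡 2) 𝓘(ℝ, Ambient m) ∞ V)
include hΦ hV

lemma continuousOn_firstVariation_chart {e : OpenPartialHomeomorph S Plane}
    (he : e ∈ IsManifold.maximalAtlas (𝓡 2) ∞ S) :
    ContinuousOn (firstVariation (Φ ∘ e.symm) (V ∘ e.symm)) e.target :=
  (hΦ.immersionOn he).continuousOn_firstVariation (contDiffOn_comp_symm hV he)

variable (hVc : HasCompactSupport V)
include hVc

/-- The integrand is continuous and vanishes off the coordinate image of the compact set `tsupport V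
∩ tsupport (ρ p)`, which lies in the chart domain. -/
lemma integrableOn_partition_mul_firstVariation
    (hρ : ρ.IsSubordinate fun p => (chartAt Plane p).source) (p : S) :
    IntegrableOn (fun x => ρ p ((chartAt Plane p).symm x) *
      firstVariation (Φ ∘ (chartAt Plane p).symm) (V ∘ (chartAt Plane p).symm) x)
      (chartAt Plane p).target := by
  have hC : IsCompact (tsupport V ∩ tsupport (ρ p)) := hVc.inter_right (isClosed_tsupport _)
  refine integrableOn_of_compact_support (chartAt Plane p).open_target.measurableSet
    (isCompact_target_inter (e := chartAt Plane p) hC fun x hx => hρ p hx.2) inter_subset_left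
    ((continuousOn_partition_comp_symm ρ p _).mul
      (continuousOn_firstVariation_chart hΦ hV (chart_mem p))) fun x hx hxK => ?_
  by_cases h1 : (chartAt Plane p).symm x ∈ tsupport V
  · have h2 : (chartAt Plane p).symm x ∉ tsupport (ρ p) := fun h2 => hxK ⟨hx, h1, h2⟩
    rw [image_eq_zero_of_notMem_tsupport h2, zero_mul]
  · rw [firstVariation_chart_eq_zero hx h1, mul_zero]

/-- The first variation of the energy of the piece of the surface seen by one chart. -/
lemma hasDerivAt_setIntegral_chart
    (hρ : ρ.IsSubordinate fun p => (chartAt Plane p).source) (p : S) :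
    HasDerivAt (fun t : ℝ => ∫ x in (chartAt Plane p).target ∩
        (chartAt Plane p).symm ⁻¹' (tsupport V), ρ p ((chartAt Plane p).symm x) *
          energyDensity (fun y => (Φ ∘ (chartAt Plane p).symm) y
            + t • (V ∘ (chartAt Plane p).symm) y) x)
      (∫ x in (chartAt Plane p).target, ρ p ((chartAt Plane p).symm x) *
        firstVariation (Φ ∘ (chartAt Plane p).symm) (V ∘ (chartAt Plane p).symm) x) 0 := by
  have hX := hΦ.immersionOn (chart_mem p)
  have hVe := contDiffOn_comp_symm hV (chart_mem p)
  have hρc := continuousOn_partition_comp_symm ρ p (chartAt Plane p)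
  have hρs : tsupport (ρ p) ⊆ (chartAt Plane p).source := hρ p
  generalize (chartAt Plane p : OpenPartialHomeomorph S Plane) = e at *
  have hC : IsCompact (tsupport V ∩ tsupport (ρ p)) := hVc.inter_right (isClosed_tsupport _)
  -- The support of `V` may leave the chart, so its trace in coordinates need not be compact;
  -- cutting it with the support of `ρ p` makes it compact without changing the integrals.
  set K : Set Plane := e.target ∩ e.symm ⁻¹' (tsupport V ∩ tsupport (ρ p))
  have hK : IsCompact K := isCompact_target_inter hC fun x hx => hρs hx.2
  have hF := hX.linearFamily hVe
  have h1 := hasDerivAt_setIntegral hF.isOpen hK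
    (fun x hx => hX.mem_linearFamily (V ∘ e.symm) hx.1) hF.contDiffOn_energyDensity
    (hρc.mono inter_subset_left)
  have h2 : ∀ t : ℝ, ∫ x in e.target ∩ e.symm ⁻¹' (tsupport V), ρ p (e.symm x) *
      energyDensity (fun y => (Φ ∘ e.symm) y + t • (V ∘ e.symm) y) x =
      ∫ x in K, ρ p (e.symm x) *
        energyDensity (fun y => (Φ ∘ e.symm) y + t • (V ∘ e.symm) y) x := fun t => by
    refine setIntegral_eq_of_subset_of_forall_sdiff_eq_zero
      (measurableSet_target_inter (isClosed_tsupport V)) (fun x hx => ⟨hx.1, hx.2.1⟩)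
      fun x hx => ?_
    have h3 : e.symm x ∉ tsupport (ρ p) := fun h3 => hx.2 ⟨hx.1.1, hx.1.2, h3⟩
    rw [image_eq_zero_of_notMem_tsupport h3, zero_mul]
  have h3 : ∫ x in e.target, ρ p (e.symm x) * firstVariation (Φ ∘ e.symm) (V ∘ e.symm) x =
      ∫ x in K, ρ p (e.symm x) * fderiv ℝ (fun q : ℝ × Plane =>
        energyDensity (fun y => (Φ ∘ e.symm) y + q.1 • (V ∘ e.symm) y) q.2) (0, x) (1, 0) := by
    rw [setIntegral_eq_of_subset_of_forall_sdiff_eq_zero (s := K) e.open_target.measurableSet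
      inter_subset_left]
    · exact setIntegral_congr_fun hK.measurableSet fun x hx => by
        rw [← hX.firstVariation_eq hVe hx.1]
    · intro x hx
      by_cases h4 : e.symm x ∈ tsupport V
      · have h5 : e.symm x ∉ tsupport (ρ p) := fun h5 => hx.2 ⟨hx.1, h4, h5⟩
        rw [image_eq_zero_of_notMem_tsupport h5, zero_mul]
      · rw [firstVariation_chart_eq_zero hx.1 h4, mul_zero]
  simp only [h2, h3]
  exact h1

/-- The first variation of the Willmore energy. -/
theorem hasDerivAt_energyOn (hρ : ρ.IsSubordinate fun p => (chartAt Plane p).source)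
    {s : Finset S} (hs : ∀ p ∉ s, ∀ x ∈ tsupport V, ρ p x = 0) :
    HasDerivAt (fun t : ℝ => energyOn ρ (fun p => Φ p + t • V p) (tsupport V))
      (∑ p ∈ s, ∫ x in (chartAt Plane p).target, ρ p ((chartAt Plane p).symm x) *
        firstVariation (Φ ∘ (chartAt Plane p).symm) (V ∘ (chartAt Plane p).symm) x) 0 := by
  have h1 : (fun t : ℝ => energyOn ρ (fun p => Φ p + t • V p) (tsupport V)) = fun t =>
      ∑ p ∈ s, ∫ x in (chartAt Plane p).target ∩
        (chartAt Plane p).symm ⁻¹' (tsupport V), ρ p ((chartAt Plane p).symm x) *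
          energyDensity (fun y => (Φ ∘ (chartAt Plane p).symm) y
            + t • (V ∘ (chartAt Plane p).symm) y) x := by
    funext t
    rw [energyOn]
    -- The same finite set of indices serves for all `t`, because the domain of integration is
    -- fixed.
    refine finsum_eq_sum_of_support_subset _ fun p hp => ?_
    by_contra h
    refine hp (setIntegral_eq_zero_of_forall_eq_zero fun x hx => ?_)
    rw [hs p h _ hx.2, zero_mul]
  rw [h1]
  exact HasDerivAt.fun_sum fun p _ => hasDerivAt_setIntegral_chart hΦ hV hVc hρ p

end Global

end Willmore

/-! ### Variations supported in a chart, and the characterization of critical points -/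

namespace Willmore

open MeasureTheory Set

section Global

variable {S : Type*} [TopologicalSpace S] [ChartedSpace Plane S]
  [IsManifold (𝓡 2) ∞ S] {m : ℕ} {Φ V : S → Ambient m}
  {ρ : SmoothPartitionOfUnity S (𝓡 2) S univ} {e e' : OpenPartialHomeomorph S Plane}
  (hΦ : IsSmoothImmersion Φ) (hV : ContMDiff (𝓡 2) 𝓘(ℝ, Ambient m) ∞ V)
include hΦ hV

/-- Integrals of first variations may be computed in any chart. -/
lemma setIntegral_firstVariation_transition (he : e ∈ IsManifold.maximalAtlas (𝓡 2) ∞ S)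
    (he' : e' ∈ IsManifold.maximalAtlas (𝓡 2) ∞ S) (hVe : tsupport V ⊆ e.source)
    {w : S → ℝ} (hw : ∀ p ∉ e'.source, w p = 0) :
    ∫ x in e'.target, w (e'.symm x) * firstVariation (Φ ∘ e'.symm) (V ∘ e'.symm) x =
      ∫ x in e.target, w (e.symm x) * firstVariation (Φ ∘ e.symm) (V ∘ e.symm) x := by
  have hφ := coordChangeOn_transition he' he
  set φ : Plane → Plane := e' ∘ e.symm with hφdef
  set W : Set Plane := e.target ∩ e.symm ⁻¹' e'.source
  have hinj : InjOn φ W := fun x hx y hy hxy =>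
    e.symm.injOn hx.1 hy.1 (e'.injOn hx.2 hy.2 hxy)
  have himage : φ '' W = e'.target ∩ e'.symm ⁻¹' e.source := by
    ext y
    constructor
    · rintro ⟨x, hx, rfl⟩
      exact ⟨e'.map_source hx.2, by
        simpa [hφdef, e'.left_inv hx.2] using e.map_target hx.1⟩
    · rintro ⟨hy, hy'⟩
      refine ⟨e (e'.symm y), ⟨e.map_source hy', ?_⟩, ?_⟩
      · simpa [e.left_inv hy'] using e'.map_target hy
      · simp [hφdef, e.left_inv hy', e'.right_inv hy]
  -- Both integrals reduce to the overlap of the charts: outside `e.source` the variation vanishes,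
  -- outside `e'.source` the weight does.
  have h1 : ∫ x in e'.target, w (e'.symm x) * firstVariation (Φ ∘ e'.symm) (V ∘ e'.symm) x =
      ∫ x in φ '' W, w (e'.symm x) * firstVariation (Φ ∘ e'.symm) (V ∘ e'.symm) x := by
    rw [himage]
    refine setIntegral_eq_of_subset_of_forall_sdiff_eq_zero e'.open_target.measurableSet
      inter_subset_left fun x hx => ?_
    rw [firstVariation_chart_eq_zero hx.1 fun h => hx.2 ⟨hx.1, hVe h⟩, mul_zero]
  have h2 : ∫ x in e.target, w (e.symm x) * firstVariation (Φ ∘ e.symm) (V ∘ e.symm) x =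
      ∫ x in W, w (e.symm x) * firstVariation (Φ ∘ e.symm) (V ∘ e.symm) x := by
    refine setIntegral_eq_of_subset_of_forall_sdiff_eq_zero e.open_target.measurableSet
      inter_subset_left fun x hx => ?_
    rw [hw _ fun h => hx.2 ⟨hx.1, h⟩, zero_mul]
  rw [h1, h2, integral_image_eq_integral_abs_det_fderiv_smul volume hφ.isOpen.measurableSet
    (fun x hx => ((hφ.contDiffOn.contDiffAt (hφ.isOpen.mem_nhds hx)).differentiableAt
      (by simp)).hasFDerivAt.hasFDerivWithinAt) hinj]
  refine setIntegral_congr_fun hφ.isOpen.measurableSet fun x hx => ?_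
  have hgerm : ∀ {f : S → Ambient m}, (f ∘ e'.symm) ∘ φ =ᶠ[nhds x] f ∘ e.symm := by
    intro f
    filter_upwards [hφ.isOpen.mem_nhds hx] with y hy
    simp [hφdef, e'.left_inv hy.2]
  -- The Jacobian from the change of variables is the one by which the first variation density
  -- transforms.
  have h3 := (hΦ.immersionOn he').firstVariation_comp (contDiffOn_comp_symm hV he') hφ hx
  rw [ImmersionOn.firstVariation_congr hgerm hgerm] at h3
  have h4 : e'.symm (φ x) = e.symm x := e'.left_inv hx.2
  rw [h3, h4, smul_eq_mul]
  ring

lemma continuousOn_areaDensity_mul_inner (he : e ∈ IsManifold.maximalAtlas (𝓡 2) ∞ S) :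
    ContinuousOn (fun x => areaDensity (Φ ∘ e.symm) x *
      inner ℝ (covDiv (Φ ∘ e.symm) (stress (Φ ∘ e.symm)) x) ((V ∘ e.symm) x)) e.target := by
  have hX := hΦ.immersionOn he
  exact hX.contDiffOn_areaDensity.continuousOn.mul
    ((hX.contDiffOn_covDiv hX.contDiffOn_stress).continuousOn.inner
      (contDiffOn_comp_symm hV he).continuousOn)

variable (hVc : HasCompactSupport V)
include hVc

lemma integrableOn_areaDensity_mul_inner (he : e ∈ IsManifold.maximalAtlas (𝓡 2) ∞ S)
    (hVe : tsupport V ⊆ e.source) :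
    IntegrableOn (fun x => areaDensity (Φ ∘ e.symm) x *
      inner ℝ (covDiv (Φ ∘ e.symm) (stress (Φ ∘ e.symm)) x) ((V ∘ e.symm) x)) e.target := by
  refine integrableOn_of_compact_support e.open_target.measurableSet
    (isCompact_target_inter hVc hVe) inter_subset_left
    (continuousOn_areaDensity_mul_inner hΦ hV he) fun x hx hxK => ?_
  rw [(comp_symm_eventuallyEq_zero hx fun h => hxK ⟨hx, h⟩).eq_of_nhds]
  simp

/-- The first variation formula in a chart containing the support of the variation. -/
lemma setIntegral_firstVariation_chart (he : e ∈ IsManifold.maximalAtlas (𝓡 2) ∞ S)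
    (hVe : tsupport V ⊆ e.source) :
    ∫ x in e.target, firstVariation (Φ ∘ e.symm) (V ∘ e.symm) x =
      -∫ x in e.target, areaDensity (Φ ∘ e.symm) x *
        inner ℝ (covDiv (Φ ∘ e.symm) (stress (Φ ∘ e.symm)) x) ((V ∘ e.symm) x) := by
  obtain ⟨Z, hZ, hZ0, hZe⟩ := (hΦ.immersionOn he).exists_flux (contDiffOn_comp_symm hV he)
  have hK : IsCompact (e.target ∩ e.symm ⁻¹' tsupport V) := isCompact_target_inter hVc hVe
  have hZK : ∀ i, ∀ x ∈ e.target, x ∉ e.target ∩ e.symm ⁻¹' tsupport V → Z i x = 0 :=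
    fun i x hx hxK => hZ0 i x hx (comp_symm_eventuallyEq_zero hx fun h => hxK ⟨hx, h⟩)
  have hZi : ∀ i, IntegrableOn (pd i (Z i)) e.target := fun i => by
    refine integrableOn_of_compact_support e.open_target.measurableSet hK inter_subset_left
      (contDiffOn_pd e.open_target (hZ i) i).continuousOn fun x hx hxK => ?_
    have h0 : Z i =ᶠ[nhds x] fun _ => (0 : ℝ) := by
      filter_upwards [(e.open_target.sdiff hK.isClosed).mem_nhds ⟨hx, hxK⟩] with y hy
      exact hZK i y hy.1 hy.2
    rw [pd_congr h0]
    simp [pd]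
  rw [setIntegral_congr_fun e.open_target.measurableSet hZe,
    integral_sub (integrable_finsetSum _ fun i _ => hZi i)
      (integrableOn_areaDensity_mul_inner hΦ hV hVc he hVe),
    integral_finsetSum _ fun i _ => hZi i]
  simp [setIntegral_pd_eq_zero e.open_target hK inter_subset_left (hZ _) (hZK _)]

/-- The first variation of the Willmore energy for a variation supported in a chart. -/
theorem sum_setIntegral_firstVariation (hρ : ρ.IsSubordinate fun p => (chartAt Plane p).source)
    {s : Finset S} (hs : ∀ p ∉ s, ∀ x ∈ tsupport V, ρ p x = 0)
    (he : e ∈ IsManifold.maximalAtlas (𝓡 2) ∞ S) (hVe : tsupport V ⊆ e.source) :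
    ∑ p ∈ s, ∫ x in (chartAt Plane p).target, ρ p ((chartAt Plane p).symm x) *
        firstVariation (Φ ∘ (chartAt Plane p).symm) (V ∘ (chartAt Plane p).symm) x =
      -∫ x in e.target, areaDensity (Φ ∘ e.symm) x *
        inner ℝ (covDiv (Φ ∘ e.symm) (stress (Φ ∘ e.symm)) x) ((V ∘ e.symm) x) := by
  rw [← setIntegral_firstVariation_chart hΦ hV hVc he hVe]
  have h1 : ∀ p, ∫ x in (chartAt Plane p).target, ρ p ((chartAt Plane p).symm x) *
        firstVariation (Φ ∘ (chartAt Plane p).symm) (V ∘ (chartAt Plane p).symm) x =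
      ∫ x in e.target, ρ p (e.symm x) * firstVariation (Φ ∘ e.symm) (V ∘ e.symm) x := fun p =>
    setIntegral_firstVariation_transition hΦ hV he (chart_mem p) hVe fun q hq =>
      image_eq_zero_of_notMem_tsupport fun h => hq (hρ p h)
  have h2 : ∀ p, IntegrableOn (fun x => ρ p (e.symm x) *
      firstVariation (Φ ∘ e.symm) (V ∘ e.symm) x) e.target := fun p => by
    refine integrableOn_of_compact_support e.open_target.measurableSet
      (isCompact_target_inter hVc hVe) inter_subset_left
      ((continuousOn_partition_comp_symm ρ p e).mul
        (continuousOn_firstVariation_chart hΦ hV he)) fun x hx hxK => ?_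
    rw [firstVariation_chart_eq_zero hx fun h => hxK ⟨hx, h⟩, mul_zero]
  simp only [h1]
  rw [← integral_finsetSum _ fun p _ => h2 p]
  refine setIntegral_congr_fun e.open_target.measurableSet fun x hx => ?_
  rw [← Finset.sum_mul]
  by_cases hxV : e.symm x ∈ tsupport V
  -- With all terms transported to the single chart `e`, the partition of unity disappears.
  · rw [sum_partition_eq_one ρ hs hxV, one_mul]
  · rw [firstVariation_chart_eq_zero hx hxV, mul_zero]

end Global

section Critical

variable {S : Type*} [TopologicalSpace S] [ChartedSpace Plane S]
  [IsManifold (𝓡 2) ∞ S] {m : ℕ} {Φ : S → Ambient m}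

/-- An immersion with divergence-free stress is Willmore. -/
theorem isWillmore_of_covDiv_stress_eq_zero (hΦ : IsSmoothImmersion Φ)
    (h0 : ∀ p : S, ∀ x ∈ (chartAt Plane p).target, covDiv (Φ ∘ (chartAt Plane p).symm)
      (stress (Φ ∘ (chartAt Plane p).symm)) x = 0) : IsWillmore Φ := by
  intro ρ hρ V hV hVc
  obtain ⟨s, hs⟩ := exists_finset_partition ρ hVc.isCompact
  have hW : ∀ q : S, ContMDiff (𝓡 2) 𝓘(ℝ, Ambient m) ∞ (fun p => ρ q p • V p) :=
    fun q => (ρ q).contMDiff.smul hV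
  have hWs : ∀ q : S, tsupport (fun p => ρ q p • V p) ⊆ tsupport V := fun q =>
    tsupport_smul_subset_right (fun p => ρ q p) V
  have hWρ : ∀ q : S, tsupport (fun p => ρ q p • V p) ⊆ (chartAt Plane q).source := fun q =>
    (tsupport_smul_subset_left (fun p => ρ q p) V).trans (hρ q)
  have hWc : ∀ q : S, HasCompactSupport (fun p => ρ q p • V p) := fun q =>
    hVc.of_isClosed_subset (isClosed_tsupport _) (hWs q)
  -- The variation is cut into pieces, each supported in one chart. The partition of unity thus
  -- serves twice: for defining the energy (index `p`) and for decomposing `V` (index `q`).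
  have hVsum : V = fun p => ∑ q ∈ s, ρ q p • V p := by
    funext p
    rw [← Finset.sum_smul]
    by_cases hp : p ∈ tsupport V
    · rw [sum_partition_eq_one ρ hs hp, one_smul]
    · rw [image_eq_zero_of_notMem_tsupport hp, smul_zero]
  have h1 := hasDerivAt_energyOn hΦ hV hVc hρ hs
  suffices h2 : ∑ p ∈ s, ∫ x in (chartAt Plane p).target, ρ p ((chartAt Plane p).symm x) *
      firstVariation (Φ ∘ (chartAt Plane p).symm) (V ∘ (chartAt Plane p).symm) x = 0 by
    rwa [h2] at h1
  have h3 : ∀ p : S, ∫ x in (chartAt Plane p).target, ρ p ((chartAt Plane p).symm x) *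
      firstVariation (Φ ∘ (chartAt Plane p).symm) (V ∘ (chartAt Plane p).symm) x =
      ∑ q ∈ s, ∫ x in (chartAt Plane p).target, ρ p ((chartAt Plane p).symm x) *
        firstVariation (Φ ∘ (chartAt Plane p).symm)
          ((fun p => ρ q p • V p) ∘ (chartAt Plane p).symm) x := fun p => by
    rw [← integral_finsetSum _ fun q _ =>
      integrableOn_partition_mul_firstVariation hΦ (hW q) (hWc q) hρ p]
    refine setIntegral_congr_fun (chartAt Plane p).open_target.measurableSet fun x hx => ?_
    beta_reduce
    rw [← Finset.mul_sum, ← (hΦ.immersionOn (chart_mem p)).firstVariation_sum s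
      (fun q _ => contDiffOn_comp_symm (hW q) (chart_mem p)) hx]
    congr 2
    funext y
    exact congrFun hVsum _
  rw [Finset.sum_congr rfl fun p _ => h3 p, Finset.sum_comm]
  refine Finset.sum_eq_zero fun q _ => ?_
  rw [sum_setIntegral_firstVariation hΦ (hW q) (hWc q) hρ
    (fun p hp x hx => hs p hp x (hWs q hx)) (chart_mem q) (hWρ q), neg_eq_zero]
  refine setIntegral_eq_zero_of_forall_eq_zero fun x hx => ?_
  rw [h0 q x hx, inner_zero_left, mul_zero]

/-- The stress of a Willmore immersion is divergence-free. -/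
theorem IsWillmore.covDiv_stress_eq_zero [T2Space S] [SecondCountableTopology S]
    (hW : IsWillmore Φ) (hΦ : IsSmoothImmersion Φ) {e : OpenPartialHomeomorph S Plane}
    (he : e ∈ IsManifold.maximalAtlas (𝓡 2) ∞ S) {x : Plane} (hx : x ∈ e.target) :
    covDiv (Φ ∘ e.symm) (stress (Φ ∘ e.symm)) x = 0 := by
  by_contra hc
  -- The Willmore condition quantifies over partitions of unity, so extracting information from it
  -- requires one to exist. Hausdorffness and second countability are used for this.
  have : LocallyCompactSpace S := ChartedSpace.locallyCompactSpace Plane S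
  obtain ⟨ρ, hρ⟩ := SmoothPartitionOfUnity.exists_isSubordinate (𝓡 2) (isClosed_univ (X := S))
    (fun p => (chartAt Plane p).source) (fun p => (chartAt Plane p).open_source)
    fun p _ => mem_iUnion.2 ⟨p, mem_chart_source Plane p⟩
  have hX := hΦ.immersionOn he
  set D : Plane → Ambient m := covDiv (Φ ∘ e.symm) (stress (Φ ∘ e.symm))
  have hG : ContinuousOn (fun y => inner ℝ (D y) (D x)) e.target :=
    (hX.contDiffOn_covDiv hX.contDiffOn_stress).continuousOn.inner continuousOn_const
  have hO := hG.isOpen_inter_preimage e.open_target (isOpen_Ioi (a := (0 : ℝ)))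
  have hO' := e.isOpen_inter_preimage hO
  have hmem : e.symm x ∈ e.source ∩
      e ⁻¹' (e.target ∩ (fun y => inner ℝ (D y) (D x)) ⁻¹' Ioi 0) := by
    refine ⟨e.map_target hx, ?_⟩
    rw [mem_preimage, e.right_inv hx]
    exact ⟨hx, real_inner_self_pos.2 hc⟩
  -- The test variation is `f` times the constant vector `D x`, with `f` a bump function at the
  -- point, supported in the chart where `D y · D x > 0`.
  obtain ⟨f, -, hf⟩ := ((SmoothBumpFunction.nhds_basis_tsupport (I := 𝓡 2) (e.symm x)).mem_iff).1
    (hO'.mem_nhds hmem)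
  have hV : ContMDiff (𝓡 2) 𝓘(ℝ, Ambient m) ∞ (fun p => f p • D x) :=
    f.contMDiff.smul contMDiff_const
  have hVs : tsupport (fun p => f p • D x) ⊆ tsupport f :=
    tsupport_smul_subset_left f fun _ => D x
  have hVc : HasCompactSupport (fun p => f p • D x) :=
    f.hasCompactSupport.of_isClosed_subset (isClosed_tsupport _) hVs
  have hVe : tsupport (fun p => f p • D x) ⊆ e.source := (hVs.trans hf).trans inter_subset_left
  obtain ⟨s, hs⟩ := exists_finset_partition ρ hVc.isCompact
  have h1 := (hasDerivAt_energyOn hΦ hV hVc hρ hs).unique (hW ρ hρ _ hV hVc)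
  rw [sum_setIntegral_firstVariation hΦ hV hVc hρ hs he hVe, neg_eq_zero] at h1
  have hF := continuousOn_areaDensity_mul_inner hΦ hV he
  have hpos : ∀ y ∈ e.target, 0 < areaDensity (Φ ∘ e.symm) y := fun y hy =>
    areaDensity_pos (hX.det_pos y hy)
  have hnonneg : ∀ y ∈ e.target, 0 ≤ areaDensity (Φ ∘ e.symm) y *
      inner ℝ (D y) (((fun p => f p • D x) ∘ e.symm) y) := fun y hy => by
    refine mul_nonneg (hpos y hy).le ?_
    rw [Function.comp_apply, inner_smul_right]
    by_cases hfy : e.symm y ∈ tsupport f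
    · have h2 := (hf hfy).2
      rw [mem_preimage, e.right_inv hy] at h2
      exact mul_nonneg f.nonneg (le_of_lt h2.2)
    · rw [image_eq_zero_of_notMem_tsupport hfy, zero_mul]
  -- The integrand is nonnegative, and it is positive at `x`, hence on a nonempty open set by
  -- continuity; its integral cannot vanish.
  refine h1.not_gt ((setIntegral_pos_iff_support_of_nonneg_ae ?_
    (integrableOn_areaDensity_mul_inner hΦ hV hVc he hVe)).2 ?_)
  · filter_upwards [ae_restrict_mem e.open_target.measurableSet] with y hy using hnonneg y hy
  · have hQ := hF.isOpen_inter_preimage e.open_target (isOpen_Ioi (a := (0 : ℝ)))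
    refine (hQ.measure_pos volume ⟨x, hx, ?_⟩).trans_le (measure_mono fun y hy => ⟨?_, hy.1⟩)
    · have hfx : f (e.symm x) = 1 := f.eq_one
      change 0 < areaDensity (Φ ∘ e.symm) x * inner ℝ (D x) (f (e.symm x) • D x)
      rw [hfx, one_smul]
      exact mul_pos (hpos x hx) (real_inner_self_pos.2 hc)
    · exact ne_of_gt hy.2

end Critical

end Willmore

theorem theorem1p2 {S : Type*} [TopologicalSpace S] [T2Space S] [SecondCountableTopology S]
    [ChartedSpace Willmore.Plane S] [IsManifold (𝓡 2) ∞ S] {m : ℕ}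
    (Φ : S → Willmore.Ambient m) (hΦ : Willmore.IsSmoothImmersion Φ) :
    -- the three conservation laws, in every smooth chart `e` of the surface, `X` being `Φ` in `e`
    (∀ e ∈ IsManifold.maximalAtlas (𝓡 2) ∞ S, ∀ x ∈ e.target,
      let X : Willmore.Plane → Willmore.Ambient m := Φ ∘ e.symm
      Willmore.covDiv X (Willmore.stress X) x = -Willmore.willmoreOp X x ∧
      Willmore.covDiv X (fun j y => Willmore.wedge (Willmore.stress X j y) (X y)
          + Willmore.wedge (Willmore.meanCurvature X y) (Willmore.gradUp X X j y)) x
        = -Willmore.wedge (Willmore.willmoreOp X x) (X x) ∧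
      Willmore.covDiv X (fun j y => inner ℝ (Willmore.stress X j y) (X y)) x
        = -inner ℝ (Willmore.willmoreOp X x) (X x)) ∧
    -- critical points of the Willmore energy are characterized by the first law without source
    (Willmore.IsWillmore Φ ↔
      ∀ e ∈ IsManifold.maximalAtlas (𝓡 2) ∞ S, ∀ x ∈ e.target,
        Willmore.covDiv (Φ ∘ e.symm) (Willmore.stress (Φ ∘ e.symm)) x = 0) := by
  refine ⟨fun e he x hx => ?_, fun hW e he x hx => hW.covDiv_stress_eq_zero hΦ he hx,
    fun h => Willmore.isWillmore_of_covDiv_stress_eq_zero hΦ fun p x hx =>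
      h _ (Willmore.chart_mem p) x hx⟩
  have hX := hΦ.immersionOn he
  exact ⟨hX.covDiv_stress hx, hX.covDiv_wedge hx, hX.covDiv_inner hx⟩
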